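/- Let $\Omega\subset\mathbb R^d$ be a closed set with boundary $\partial\Omega$; write $B(x,r)$ for the open ball. For $x\in\partial\Omega$ and $r>0$ let $N_{x,r}=\{n\in\mathbb R^d:\|n\|=1,\ B(x-rn,r)\cap\Omega=\emptyset\}$, and let $N_x=\bigcup_{r>0}N_{x,r}$ be the set of inward unit normals at $x$. Assume: (i) (uniform exterior sphere condition) there is $r_0>0$ such that $N_{x,r_0}\neq\emptyset$ for every $x\in\partial\Omega$; (ii) (uniform cone condition) there are $\delta>0$ and $\alpha\in[0,1)$ such that for every $x\in\partial\Omega$ there is a unit vector $m$ with $C(y,m,\alpha)\cap B(x,\delta)\subset\Omega$ for all $y\in B(x,\delta)\cap\partial\Omega$, where $C(y,m,\alpha)=\{z:(z-y)\cdot m\ge\alpha\|z-y\|\}$; (iii) $v_t:\Omega\to\mathbb R^d$, $t\in[0,1]$, is Lipschitz continuous on $\Omega$ with a constant independent of $t$, and $t\mapsto v_t(y)$ is (Lebesgue) integrable on $[0,1]$ for every $y\in\Omega$. Then for every $x\in\Omega$ the reflected ODE $$\mathrm d\phi_t=v_t(\phi_t)\,\mathrm dt+\mathrm dL_t,\qquad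 \phi_0=x,$$ has a unique solution on $[0,1]$. Here a solution is a pair $(\phi,L)$ of functions on $[0,1]$ such that $\phi$ is continuous with values in $\Omega$, $\phi_t=x+\int_0^t v_s(\phi_s)\,\mathrm ds+L_t$ for all $t\in[0,1]$, and $L_t=\int_{(0,t]}n_s\,\mathrm dl_s$ for some continuous nondecreasing $l$ with $l_0=0$ and some measurable $n$, where $\phi_s\in\partial\Omega$ and $n_s\in N_{\phi_s}$ for $\mathrm dl$-almost every $s$. Uniqueness means that any two solutions $(\phi,L)$, $(\phi',L')$ coincide on $[0,1]$. -/

import Mathlib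

open Set MeasureTheory Metric
open scoped NNReal

section ReflectedODE

variable {E : Type*} [NormedAddCommGroup E] [InnerProductSpace ℝ E]

/-- The inward unit normals to `Ω` at `x` of radius `r`: unit vectors `n` such that the open ball
of radius `r` centred at `x - r n` (hence touching `x` from outside) does not meet `Ω`. -/
def inwardNormalsOfRadius (Ω : Set E) (r : ℝ) (x : E) : Set E :=
  {n | ‖n‖ = 1 ∧ ball (x - r • n) r ∩ Ω = ∅}

/-- The inward unit normals to `Ω` at `x`. At a boundary point where the boundary is not smooth
there may be several of them. -/
def inwardNormals (Ω : Set E) (x : E) : Set E :=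
  {n | ∃ r : ℝ, 0 < r ∧ n ∈ inwardNormalsOfRadius Ω r x}

/-- Uniform exterior sphere condition. -/
def UniformExteriorSphere (Ω : Set E) : Prop :=
  ∃ r₀ : ℝ, 0 < r₀ ∧ ∀ x ∈ frontier Ω, (inwardNormalsOfRadius Ω r₀ x).Nonempty

/-- The closed cone with apex `y`, axis `m` and aperture parameter `α`. -/
def solidCone (y m : E) (α : ℝ) : Set E :=
  {z | ‖z - y‖ * α ≤ inner ℝ (z - y) m}

/-- Uniform (interior) cone condition. -/
def UniformCone (Ω : Set E) : Prop :=
  ∃ δ : ℝ, 0 < δ ∧ ∃ α : ℝ, 0 ≤ α ∧ α < 1 ∧ ∀ x ∈ frontier Ω, ∃ m : E, ‖m‖ = 1 ∧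
    ∀ y ∈ ball x δ ∩ frontier Ω, solidCone y m α ∩ ball x δ ⊆ Ω

/-- `dL = n dl` on `[0,1]` with `L 0 = 0`, where `l` is continuous and nondecreasing, `l 0 = 0`,
`dl` charges only the times at which the path `φ` is on the boundary of `Ω`, and `n s` is an inward
unit normal to `Ω` at `φ s` for `dl`-almost every time `s`. -/
def IsNormalReflection (Ω : Set E) (φ L : ℝ → E) : Prop :=
  ∃ (l : StieltjesFunction ℝ) (n : ℝ → E),
    l 0 = 0 ∧
    ContinuousOn l (Icc 0 1) ∧
    (∀ᵐ s ∂(l.measure.restrict (Ioc 0 1)), φ s ∈ frontier Ω) ∧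
    AEStronglyMeasurable n (l.measure.restrict (Ioc 0 1)) ∧
    (∀ᵐ s ∂(l.measure.restrict (Ioc 0 1)), n s ∈ inwardNormals Ω (φ s)) ∧
    ∀ t ∈ Icc (0 : ℝ) 1, L t = ∫ s in Ioc 0 t, n s ∂l.measure

/-- `(φ, L)` solves `dφ = v_t(φ_t) dt + dL_t`, `φ_0 = x`, on `[0,1]`, with normal reflection at the
boundary of `Ω`. Only the values of `φ` and `L` on `[0,1]` matter. -/
structure IsReflectedSolution (Ω : Set E) (v : ℝ → E → E) (x : E) (φ L : ℝ → E) : Prop where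
  continuousOn : ContinuousOn φ (Icc 0 1)
  mem : ∀ t ∈ Icc (0 : ℝ) 1, φ t ∈ Ω
  initial : φ 0 = x
  integrable : IntegrableOn (fun s => v s (φ s)) (Icc 0 1)
  equation : ∀ t ∈ Icc (0 : ℝ) 1, φ t = x + (∫ s in (0 : ℝ)..t, v s (φ s)) + L t
  reflection : IsNormalReflection Ω φ L

end ReflectedODE

/-!
Why the reflected ODE is well posed.

*Geometry.* Inward normals may a priori come with arbitrarily small exterior balls, but sphere and
cone conditions together give one constant `C` with `⟪y - x, n⟫ ≥ -C ‖y - x‖²` for every boundary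
point `x`, every inward normal `n` at `x` and every `y ∈ Ω`
(`exists_forall_inwardNormal_inner_ge`). Indeed `Ω` is locally the epigraph, in the direction of the
cone axis `m`, of a semiconvex function: the point of parameter `t` of a chord of length `h` between
nearby points of `Ω`, pushed by a multiple of `t (1 - t) h²` along `m`, stays in `Ω` (`chord_mem`),
because otherwise the exterior ball of radius `r₀` at the first boundary point above it would contain
an end point of the chord. Letting `t → 0` gives the inequality for a normal of any radius.

*Uniqueness.* The inequality makes the reflection terms contribute at most
`2 C ‖φ - φ'‖² (dl + dl')` to `d‖φ - φ'‖²`, and the drift at most `2 K ‖φ - φ'‖² dt`. Gronwall's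
lemma is applied to increments over short intervals, which avoids a chain rule for Stieltjes
integrals (`IsReflectedSolution.sq_dist_increment`, `eq_zero_of_small_increments`).

*Existence.* The catching-up scheme follows the drift frozen at the current node and then projects
on `Ω`. Its increments are dominated by those of one absolutely continuous function, since the drift
grows at most linearly, and each correction is an inward normal (`inner_sub_nearest_ge`). A limit `ψ`
with reflection term `Λ` therefore satisfies an integrated form of the normal inequality
(`exists_catchingUp_limit`). As `Λ` is absolutely continuous, differentiating that inequality shows
that `Λ'` is a.e. a multiple of an inward normal, and `dl = ‖Λ'‖ dt`, `n = Λ' / ‖Λ'‖` represent `Λ`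
(`isNormalReflection_of_increments`).
-/

open Filter Topology

/-! ### Uniform normal inequality -/

section Geometry

variable {E : Type*} [NormedAddCommGroup E] [InnerProductSpace ℝ E] {Ω : Set E}

theorem mem_inwardNormalsOfRadius_iff {r : ℝ} (hr : 0 < r) {x n : E} :
    n ∈ inwardNormalsOfRadius Ω r x ↔
      ‖n‖ = 1 ∧ ∀ z ∈ Ω, -‖z - x‖ ^ 2 ≤ 2 * r * inner ℝ (z - x) n := by
  unfold inwardNormalsOfRadius
  rw [mem_ofPred_eq]
  refine and_congr_right fun hn => ?_
  have key : ∀ z : E, dist z (x - r • n) ^ 2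
      = ‖z - x‖ ^ 2 + 2 * r * inner ℝ (z - x) n + r ^ 2 := fun z => by
    rw [dist_eq_norm, show z - (x - r • n) = (z - x) + r • n by abel, norm_add_sq_real,
      inner_smul_right, norm_smul, hn, Real.norm_of_nonneg hr.le]
    ring
  rw [← disjoint_iff_inter_eq_empty, disjoint_right]
  refine forall₂_congr fun z _ => ?_
  rw [mem_ball, not_lt, ← sq_le_sq₀ hr.le dist_nonneg, key]
  constructor <;> intro h <;> linarith

/-- The boundary inequality along a curve `x + ε u(ε)` of points of `Ω` issued from `x`: the
initial direction `u 0` makes a nonnegative inner product with every inward normal at `x`,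
whatever its radius, since the exterior sphere inequality has an error of order `ε²` only. -/
theorem inner_inwardNormal_nonneg {x n : E} (hn : n ∈ inwardNormals Ω x) {u : ℝ → E}
    (hu : ContinuousAt u 0) (h : ∀ᶠ ε in 𝓝[>] (0 : ℝ), x + ε • u ε ∈ Ω) :
    0 ≤ inner ℝ (u 0) n := by
  obtain ⟨r, hr, hn⟩ := hn
  obtain ⟨-, hn⟩ := (mem_inwardNormalsOfRadius_iff hr).1 hn
  have hlim : ContinuousAt (fun ε : ℝ => 2 * r * inner ℝ (u ε) n + ε * ‖u ε‖ ^ 2) 0 := by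
    fun_prop
  have h0 := ge_of_tendsto (b := 0) (hlim.tendsto.mono_left (nhdsWithin_le_nhds (s := Ioi 0))) ?_
  · simpa [hr] using h0
  filter_upwards [h, self_mem_nhdsWithin] with ε hε hpos
  rw [mem_Ioi] at hpos
  have := hn _ hε
  rw [add_sub_cancel_left, norm_smul, inner_smul_left, Real.norm_of_nonneg hpos.le] at this
  simp only [conj_trivial] at this
  refine nonneg_of_mul_nonneg_right (a := ε) ?_ hpos
  linarith

/-- A point of `Ω` that has an inward normal lies on the boundary: it is the limit of centres
`x - ε n` of smaller exterior balls. -/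
theorem mem_frontier_of_inwardNormal {x n : E} (hx : x ∈ Ω) (hn : n ∈ inwardNormals Ω x) :
    x ∈ frontier Ω := by
  refine ⟨subset_closure hx, fun hint => ?_⟩
  have hn1 : ‖n‖ = 1 := by obtain ⟨r, -, h⟩ := hn; exact h.1
  have hcont : ContinuousAt (fun ε : ℝ => x + ε • (-n)) 0 := by fun_prop
  have hmem : ∀ᶠ ε in 𝓝 (0 : ℝ), x + ε • (-n) ∈ Ω :=
    hcont (by simpa using mem_interior_iff_mem_nhds.1 hint)
  have := inner_inwardNormal_nonneg (u := fun _ => -n) hn (by fun_prop)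
    (hmem.filter_mono nhdsWithin_le_nhds)
  rw [inner_neg_left, real_inner_self_eq_norm_sq, hn1] at this
  norm_num at this

/-- The interior cone at a boundary point keeps the inward normals away from the orthogonal of
its axis. -/
theorem le_inner_axis_inwardNormal {x x' m n : E} {α δ : ℝ} (hα : 0 ≤ α) (hα1 : α < 1)
    (hm : ‖m‖ = 1) (hn1 : ‖n‖ = 1) (hx : x ∈ ball x' δ)
    (hcone : solidCone x m α ∩ ball x' δ ⊆ Ω) (hn : n ∈ inwardNormals Ω x) :
    (1 - α) / (1 + α) ≤ inner ℝ m n := by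
  set η := (1 - α) / (1 + α) with hη
  have hη0 : 0 ≤ η := by rw [hη]; apply div_nonneg <;> linarith
  have hη' : η * (1 + α) = 1 - α := by rw [hη]; field_simp
  have hmn : inner ℝ n m ≤ 1 := by
    simpa [hm, hn1] using real_inner_le_norm n m
  have hu : 0 ≤ inner ℝ (m - η • n) n := by
    refine inner_inwardNormal_nonneg (u := fun _ => m - η • n) hn (by fun_prop) ?_
    have hcont : ContinuousAt (fun ε : ℝ => x + ε • (m - η • n)) 0 := by fun_prop
    have hball : ∀ᶠ ε in 𝓝 (0 : ℝ), x + ε • (m - η • n) ∈ ball x' δ :=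
      hcont (by simpa using isOpen_ball.mem_nhds hx)
    filter_upwards [hball.filter_mono nhdsWithin_le_nhds, self_mem_nhdsWithin] with ε hε hpos
    rw [mem_Ioi] at hpos
    refine hcone ⟨?_, hε⟩
    unfold solidCone
    rw [mem_ofPred_eq, add_sub_cancel_left, norm_smul, Real.norm_of_nonneg hpos.le,
      inner_smul_left, conj_trivial, mul_assoc]
    refine mul_le_mul_of_nonneg_left ?_ hpos.le
    have h1 : ‖m - η • n‖ ≤ 1 + η := by
      refine (norm_sub_le _ _).trans ?_
      rw [hm, norm_smul, hn1, Real.norm_of_nonneg hη0, mul_one]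
    have h2 : inner ℝ (m - η • n) m = 1 - η * inner ℝ n m := by
      rw [inner_sub_left, inner_smul_left, real_inner_self_eq_norm_sq, hm]; simp
    rw [h2]
    nlinarith
  rw [inner_sub_left, inner_smul_left, real_inner_self_eq_norm_sq, hn1] at hu
  simpa using hu

/-- On a ray that starts outside a closed set and ends inside there is a boundary point, at
positive distance from the starting point. -/
theorem exists_frontier_on_ray (hΩ : IsClosed Ω) {p m : E} {a b : ℝ} (hab : a ≤ b)
    (ha : p + a • m ∉ Ω) (hb : p + b • m ∈ Ω) :
    ∃ s, a < s ∧ s ≤ b ∧ p + s • m ∈ frontier Ω := by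
  have hpre : IsPreconnected ((fun s : ℝ => p + s • m) '' Icc a b) :=
    isPreconnected_Icc.image _ (by fun_prop)
  have hne : ((fun s : ℝ => p + s • m) '' Icc a b ∩ frontier Ω).Nonempty := by
    by_contra hempty
    rw [not_nonempty_iff_eq_empty, ← disjoint_iff_inter_eq_empty, disjoint_left] at hempty
    obtain ⟨z, -, hz, hz'⟩ := hpre (interior Ω) Ωᶜ isOpen_interior hΩ.isOpen_compl
      (fun z hz => by
        by_cases h : z ∈ Ω
        · exact Or.inl (not_not.1 fun hi => hempty hz ⟨subset_closure h, hi⟩)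
        · exact Or.inr h)
      ⟨_, mem_image_of_mem _ (right_mem_Icc.2 hab),
        not_not.1 fun hi => hempty (mem_image_of_mem _ (right_mem_Icc.2 hab))
          ⟨subset_closure hb, hi⟩⟩
      ⟨_, mem_image_of_mem _ (left_mem_Icc.2 hab), ha⟩
    exact hz' (interior_subset hz)
  obtain ⟨_, ⟨s, hs, rfl⟩, hfr⟩ := hne
  refine ⟨s, lt_of_le_of_ne hs.1 ?_, hs.2, hfr⟩
  rintro rfl
  exact ha (hΩ.frontier_subset hfr)

/-- Semiconvexity of `Ω` in the direction of the cone axis: a chord between nearby points of `Ω`,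
pushed along the axis by a quadratically small amount, stays in `Ω`. Otherwise the first boundary
point met further along the axis would carry an exterior sphere of radius `r₀`, which would have
to contain one of the end points of the chord. -/
theorem chord_mem {x y m : E} {α δ r₀ t : ℝ} (hΩ : IsClosed Ω) (hr₀ : 0 < r₀)
    (hsphere : ∀ x ∈ frontier Ω, (inwardNormalsOfRadius Ω r₀ x).Nonempty)
    (hα : 0 ≤ α) (hα1 : α < 1) (hm : ‖m‖ = 1)
    (hcone : ∀ y ∈ ball x δ ∩ frontier Ω, solidCone y m α ∩ ball x δ ⊆ Ω)
    (hx : x ∈ frontier Ω) (hy : y ∈ Ω) {η : ℝ} (hη : η = (1 - α) / (1 + α))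
    (h1 : ‖y - x‖ ≤ r₀ * η ^ 2) (h2 : ‖y - x‖ + ‖y - x‖ / η < δ)
    (ht : 0 ≤ t) (ht1 : t ≤ 1) :
    x + t • (y - x) + ((1 / (r₀ * η)) * (t * (1 - t)) * ‖y - x‖ ^ 2) • m ∈ Ω := by
  have hη0 : 0 < η := by rw [hη]; apply div_pos <;> linarith
  have hηα : η * (1 + α) = 1 - α := by rw [hη]; field_simp
  have hη1 : η ≤ 1 := by nlinarith
  set h := ‖y - x‖ with hh
  have hh0 : 0 ≤ h := norm_nonneg _
  set s := (1 / (r₀ * η)) * (t * (1 - t)) * h ^ 2 with hs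
  have hhη : η * (h / η) = h := by field_simp
  have htt : 0 ≤ t * (1 - t) := mul_nonneg ht (by linarith)
  have hseq : r₀ * η * s = t * (1 - t) * h ^ 2 := by rw [hs]; field_simp
  have hhη0 : 0 ≤ h / η := by positivity
  have hhle : h ≤ h / η := by nlinarith
  have hsle : s ≤ h / η := by
    have : r₀ * η * s ≤ r₀ * η * h := by
      rw [hseq]
      have : t * (1 - t) ≤ 1 := by nlinarith
      have h3 : h ≤ r₀ * η := h1.trans (by nlinarith [mul_pos hr₀ hη0])
      nlinarith [mul_nonneg hh0 hh0]
    exact (le_of_mul_le_mul_left this (by positivity)).trans hhle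
  have hdist : ∀ a, 0 ≤ a → a ≤ h / η → ‖t • (y - x) + a • m‖ ≤ h + h / η := fun a ha ha' => by
    refine (norm_add_le _ _).trans (add_le_add ?_ ?_)
    · rw [norm_smul, Real.norm_of_nonneg ht]; nlinarith
    · rw [norm_smul, Real.norm_of_nonneg ha, hm]; linarith
  have hball : ∀ a, 0 ≤ a → a ≤ h / η → x + t • (y - x) + a • m ∈ ball x δ := fun a ha ha' => by
    rw [mem_ball, dist_eq_norm, add_assoc, add_sub_cancel_left]
    exact (hdist a ha ha').trans_lt h2
  have hxball : x ∈ ball x δ := mem_ball_self (by linarith)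
  -- at height `h / η` above the chord, the cone at `x` is reached
  have htop : x + t • (y - x) + (h / η) • m ∈ Ω := by
    refine hcone x ⟨hxball, hx⟩ ⟨?_, hball _ hhη0 le_rfl⟩
    unfold solidCone
    rw [mem_ofPred_eq, add_assoc, add_sub_cancel_left, inner_add_left, inner_smul_left,
      inner_smul_left, real_inner_self_eq_norm_sq, hm]
    simp only [conj_trivial]
    have h3 := hdist _ hhη0 le_rfl
    have h4 : -h ≤ inner ℝ (y - x) m := by
      have := neg_le_of_abs_le (abs_real_inner_le_norm (y - x) m)
      rwa [hm, mul_one] at this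
    have h5 : -h ≤ t * inner ℝ (y - x) m := by nlinarith
    have h6 : α * (h + h / η) = h / η - h := by
      have : (η * (1 + α)) * (h / η) = (1 - α) * (h / η) := by rw [hηα]
      nlinarith
    nlinarith
  by_contra hnot
  obtain ⟨s', hss', hs'le, hfr⟩ := exists_frontier_on_ray hΩ hsle hnot htop
  have hs0 : 0 ≤ s := by rw [hs]; positivity
  have hs'0 : 0 ≤ s' := hs0.trans hss'.le
  set q := x + t • (y - x) + s' • m with hq
  obtain ⟨n, hn⟩ := hsphere q hfr
  have hqb := hball s' hs'0 hs'le
  obtain ⟨hn1, hnz⟩ := (mem_inwardNormalsOfRadius_iff hr₀).1 hn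
  have hmn := le_inner_axis_inwardNormal hα hα1 hm hn1 hqb (hcone q ⟨hqb, hfr⟩) ⟨r₀, hr₀, hn⟩
  rw [← hη] at hmn
  have hzx := hnz x (hΩ.frontier_subset hx)
  have hzy := hnz y hy
  have e1 : x - q = -(t • (y - x) + s' • m) := by rw [hq]; abel
  have e2 : y - q = (1 - t) • (y - x) - s' • m := by rw [hq, sub_smul, one_smul]; abel
  rw [e1, norm_neg, norm_add_sq_real, inner_neg_left, inner_add_left] at hzx
  rw [e2, norm_sub_sq_real, inner_sub_left] at hzy
  simp only [norm_smul, inner_smul_left, inner_smul_right, conj_trivial, hm, mul_pow,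
    Real.norm_eq_abs, sq_abs, ← hh] at hzx hzy
  have hcomb : 2 * r₀ * s' * inner ℝ m n ≤ t * (1 - t) * h ^ 2 + s' ^ 2 := by
    -- the convex combination of the sphere inequalities at `q` for the two end points of the chord
    have hA := mul_le_mul_of_nonneg_left hzx (by linarith : (0:ℝ) ≤ 1 - t)
    have hB := mul_le_mul_of_nonneg_left hzy ht
    linarith
  have hs'r : s' ≤ r₀ * η := by
    refine hs'le.trans ?_
    rw [div_le_iff₀ hη0]
    linarith [show r₀ * η * η = r₀ * η ^ 2 by ring]
  have hlow : 2 * r₀ * s' * η ≤ 2 * r₀ * s' * inner ℝ m n := by gcongr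
  have : r₀ * η * s' ≤ r₀ * η * s := by
    rw [hseq]
    nlinarith
  exact absurd (le_of_mul_le_mul_left this (by positivity)) (not_le.2 hss')

/-- Under the sphere and cone conditions all inward normals, whatever the radius of their exterior
ball, satisfy the exterior sphere inequality with one constant. -/
theorem exists_forall_inwardNormal_inner_ge (hΩ : IsClosed Ω) (hsphere : UniformExteriorSphere Ω)
    (hcone : UniformCone Ω) :
    ∃ C : ℝ, 0 ≤ C ∧ ∀ x ∈ frontier Ω, ∀ n ∈ inwardNormals Ω x, ∀ y ∈ Ω,
      -(C * ‖y - x‖ ^ 2) ≤ inner ℝ (y - x) n := by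
  obtain ⟨r₀, hr₀, hsphere⟩ := hsphere
  obtain ⟨δ, hδ, α, hα, hα1, hcone⟩ := hcone
  obtain ⟨η, hη⟩ : ∃ η, η = (1 - α) / (1 + α) := ⟨_, rfl⟩
  have hη0 : 0 < η := by rw [hη]; apply div_pos <;> linarith
  obtain ⟨h₀, hh₀, hh1, hh2⟩ : ∃ h₀ : ℝ, 0 < h₀ ∧ h₀ ≤ r₀ * η ^ 2 ∧ h₀ + h₀ / η < δ := by
    have : ∀ᶠ h₀ in 𝓝[>] (0 : ℝ), h₀ + h₀ / η < δ ∧ h₀ < r₀ * η ^ 2 := by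
      refine Filter.Eventually.filter_mono nhdsWithin_le_nhds (Filter.Eventually.and ?_ ?_)
      · exact ContinuousAt.eventually_lt (f := fun h : ℝ => h + h / η) (by fun_prop)
          continuousAt_const (by simpa)
      · exact eventually_lt_nhds (by positivity)
    obtain ⟨h₀, ⟨ha, hb⟩, hc⟩ := (this.and self_mem_nhdsWithin).exists
    exact ⟨h₀, hc, hb.le, ha⟩
  -- `1 / (r₀ η)` serves for `‖y - x‖ ≤ h₀`, and `1 / h₀` beyond, where Cauchy-Schwarz suffices
  refine ⟨1 / (r₀ * η) + 1 / h₀, by positivity, fun x hx n hn y hy => ?_⟩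
  have hn1 : ‖n‖ = 1 := by obtain ⟨r, -, h⟩ := hn; exact h.1
  have hnonneg : 0 ≤ ‖y - x‖ ^ 2 := by positivity
  rcases le_total ‖y - x‖ h₀ with hle | hle
  · obtain ⟨m, hm, hcone⟩ := hcone x hx
    have h0 := inner_inwardNormal_nonneg (Ω := Ω)
      (u := fun t : ℝ => (y - x) + (1 / (r₀ * η) * (1 - t) * ‖y - x‖ ^ 2) • m) hn
      (by fun_prop) ?_
    · simp only [sub_zero, mul_one, inner_add_left, inner_smul_left, conj_trivial] at h0
      have hmn : inner ℝ m n ≤ 1 := by simpa [hm, hn1] using real_inner_le_norm m n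
      have h3 : 1 / (r₀ * η) * ‖y - x‖ ^ 2 * inner ℝ m n ≤ 1 / (r₀ * η) * ‖y - x‖ ^ 2 * 1 := by
        gcongr
      have h4 : 0 ≤ 1 / h₀ * ‖y - x‖ ^ 2 := by positivity
      linarith
    · have hlt : ∀ᶠ t in 𝓝[>] (0 : ℝ), t < 1 :=
        (eventually_lt_nhds one_pos).filter_mono nhdsWithin_le_nhds
      filter_upwards [hlt, self_mem_nhdsWithin] with t ht1 ht
      rw [mem_Ioi] at ht
      have h2 : ‖y - x‖ + ‖y - x‖ / η < δ := lt_of_le_of_lt (by gcongr) hh2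
      have := chord_mem hΩ hr₀ hsphere hα hα1 hm hcone hx hy hη (hle.trans hh1) h2 ht.le ht1.le
      convert this using 1
      rw [smul_add, smul_smul, add_assoc]
      congr 3
      ring
  · have h3 : -‖y - x‖ ≤ inner ℝ (y - x) n := by
      have := neg_le_of_abs_le (abs_real_inner_le_norm (y - x) n)
      rwa [hn1, mul_one] at this
    have h4 : ‖y - x‖ ≤ 1 / h₀ * ‖y - x‖ ^ 2 := by
      rw [one_div, inv_mul_eq_div, le_div_iff₀ hh₀]
      nlinarith [norm_nonneg (y - x)]
    have h5 : 0 ≤ 1 / (r₀ * η) * ‖y - x‖ ^ 2 := by positivity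
    linarith

/-- The displacement from a point `q` to its nearest point `p` in `Ω` is an inward normal. -/
theorem inner_sub_nearest_ge {C : ℝ}
    (hC : ∀ x ∈ frontier Ω, ∀ n ∈ inwardNormals Ω x, ∀ y ∈ Ω,
      -(C * ‖y - x‖ ^ 2) ≤ inner ℝ (y - x) n)
    {p q : E} (hp : p ∈ Ω) (hmin : ∀ z ∈ Ω, ‖p - q‖ ≤ ‖z - q‖) {z : E} (hz : z ∈ Ω) :
    -(C * ‖p - q‖ * ‖z - p‖ ^ 2) ≤ inner ℝ (z - p) (p - q) := by
  rcases eq_or_ne p q with rfl | hne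
  · simp
  have hd : 0 < ‖p - q‖ := norm_pos_iff.2 (sub_ne_zero.2 hne)
  have hn : ‖p - q‖⁻¹ • (p - q) ∈ inwardNormals Ω p := by
    refine ⟨‖p - q‖, hd, ?_, ?_⟩
    · rw [norm_smul, norm_inv, norm_norm, inv_mul_cancel₀ hd.ne']
    · rw [smul_inv_smul₀ hd.ne', sub_sub_cancel, ← disjoint_iff_inter_eq_empty, disjoint_right]
      intro w hw
      rw [mem_ball, not_lt, dist_eq_norm]
      exact hmin w hw
  have h := hC p (mem_frontier_of_inwardNormal hp hn) _ hn z hz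
  rw [inner_smul_right] at h
  have := mul_le_mul_of_nonneg_left h hd.le
  rw [mul_inv_cancel_left₀ hd.ne'] at this
  linarith

end Geometry

/-! ### Uniqueness -/

section Uniqueness

variable {E : Type*} [NormedAddCommGroup E] [InnerProductSpace ℝ E] {Ω : Set E}

/-- A Gronwall lemma with respect to a nondecreasing function `M`, for a nonnegative `u` whose
increments over short intervals are at most `A (u s + η) (M t - M s)`. -/
theorem eq_zero_of_small_increments {u M : ℝ → ℝ} {A : ℝ} (hu : ∀ t, 0 ≤ u t) (hu0 : u 0 = 0)
    (h : ∀ η : ℝ, 0 < η → η ≤ 1 → ∃ δ > 0, ∀ s t, 0 ≤ s → s ≤ t → t ≤ 1 → t - s ≤ δ →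
      u t ≤ u s + A * (u s + η) * (M t - M s)) {T : ℝ} (hT : T ∈ Icc (0 : ℝ) 1) : u T = 0 := by
  have key : ∀ η : ℝ, 0 < η → η ≤ 1 → u T ≤ η * Real.exp (A * (M T - M 0)) := by
    intro η hη hη1
    obtain ⟨δ, hδ, hstep⟩ := h η hη hη1
    obtain ⟨N, hN⟩ := exists_nat_gt (1 / δ)
    have hN0 : (0 : ℝ) < N := lt_trans (by positivity) hN
    have hTN : T / N ≤ δ := by
      rw [div_le_iff₀ hN0]
      rw [div_lt_iff₀ hδ] at hN
      linarith [hT.2]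
    have hind : ∀ k : ℕ, k ≤ N →
        u (k * (T / N)) + η ≤ η * Real.exp (A * (M (k * (T / N)) - M 0)) := by
      intro k
      induction k with
      | zero => intro _; simp [hu0]
      | succ k ih =>
        intro hk
        have hTN0 : 0 ≤ T / N := div_nonneg hT.1 hN0.le
        have hs0 : 0 ≤ k * (T / N) := by positivity
        have hle : k * (T / N) ≤ (k + 1 : ℕ) * (T / N) := by gcongr; simp
        have ht1 : (k + 1 : ℕ) * (T / N) ≤ 1 := by
          refine le_trans ?_ hT.2
          calc ((k + 1 : ℕ) : ℝ) * (T / N) ≤ N * (T / N) := by gcongr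
            _ = T := by field_simp
        have hst := hstep _ _ hs0 hle ht1 (by push_cast; linarith)
        have ih := ih (by omega)
        set s := k * (T / N)
        set t := (k + 1 : ℕ) * (T / N)
        have hexp := Real.add_one_le_exp (A * (M t - M s))
        have hus : 0 ≤ u s + η := by linarith [hu s]
        calc u t + η ≤ (u s + η) * (A * (M t - M s) + 1) := by linarith
          _ ≤ (u s + η) * Real.exp (A * (M t - M s)) := by gcongr
          _ ≤ η * Real.exp (A * (M s - M 0)) * Real.exp (A * (M t - M s)) := by gcongr
          _ = η * Real.exp (A * (M t - M 0)) := by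
              rw [mul_assoc, ← Real.exp_add]; congr 2; ring
    have := hind N le_rfl
    rw [show (N : ℝ) * (T / N) = T by field_simp] at this
    linarith
  have hlim : Tendsto (fun η : ℝ => η * Real.exp (A * (M T - M 0))) (𝓝[>] 0) (𝓝 0) := by
    have : ContinuousAt (fun η : ℝ => η * Real.exp (A * (M T - M 0))) 0 := by fun_prop
    simpa using this.tendsto.mono_left nhdsWithin_le_nhds
  refine le_antisymm (ge_of_tendsto hlim ?_) (hu T)
  filter_upwards [self_mem_nhdsWithin, (eventually_le_nhds one_pos).filter_mono
    nhdsWithin_le_nhds] with η hη hη1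
  exact key η hη hη1

/-- What uniqueness uses of the reflection term: its increments are controlled by those of the
nondecreasing function `l`, in norm and in every direction. -/
theorem IsNormalReflection.exists_increment_bound [CompleteSpace E] {φ L : ℝ → E}
    (h : IsNormalReflection Ω φ L) :
    ∃ l : ℝ → ℝ, Monotone l ∧ ∀ s t, 0 ≤ s → s ≤ t → t ≤ 1 →
      ‖L t - L s‖ ≤ l t - l s ∧
      ∀ (w : E) (c : ℝ), (∀ u ∈ Ioc s t, φ u ∈ frontier Ω → ∀ n ∈ inwardNormals Ω (φ u),
        inner ℝ w n ≤ c) → inner ℝ w (L t - L s) ≤ c * (l t - l s) := by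
  obtain ⟨l, n, -, -, hfr, hmeas, hn, hL⟩ := h
  refine ⟨l, l.mono, fun s t hs hst ht => ?_⟩
  have hnorm : ∀ᵐ u ∂(l.measure.restrict (Ioc 0 1)), ‖n u‖ ≤ 1 := by
    filter_upwards [hn] with u hu
    obtain ⟨r, -, hu⟩ := hu
    exact hu.1.le
  have : IsFiniteMeasure (l.measure.restrict (Ioc 0 1)) := ⟨by simp⟩
  have hint : IntegrableOn n (Ioc 0 1) l.measure := Integrable.of_bound hmeas 1 hnorm
  have hsub : Ioc s t ⊆ Ioc 0 1 := Ioc_subset_Ioc hs ht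
  have hLst : L t - L s = ∫ u in Ioc s t, n u ∂l.measure := by
    rw [hL t ⟨hs.trans hst, ht⟩, hL s ⟨hs, hst.trans ht⟩, ← Ioc_union_Ioc_eq_Ioc hs hst,
      setIntegral_union (Ioc_disjoint_Ioc_of_le le_rfl) measurableSet_Ioc
        (hint.mono_set (Ioc_subset_Ioc le_rfl (hst.trans ht))) (hint.mono_set hsub),
      add_sub_cancel_left]
  have hreal : l.measure.real (Ioc s t) = l t - l s := by
    rw [measureReal_def, StieltjesFunction.measure_Ioc,
      ENNReal.toReal_ofReal (sub_nonneg.2 (l.mono hst))]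
  have hmono := Measure.restrict_mono hsub (le_refl l.measure)
  rw [hLst, ← hreal]
  refine ⟨?_, fun w c hw => ?_⟩
  · have := norm_setIntegral_le_of_norm_le_const_ae (μ := l.measure) (s := Ioc s t) (f := n)
      (C := 1) (by simp) (ae_mono hmono hnorm)
    simpa using this
  · rw [← integral_inner (hint.mono_set hsub)]
    have hc : ∫ u in Ioc s t, c ∂l.measure = c * l.measure.real (Ioc s t) := by
      rw [setIntegral_const, smul_eq_mul, mul_comm]
    rw [← hc]
    refine integral_mono_ae ((hint.mono_set hsub).const_inner w)
      (integrableOn_const (by simp)) ?_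
    filter_upwards [ae_mono hmono hfr, ae_mono hmono hn, ae_restrict_mem measurableSet_Ioc]
      with u h1 h2 h3
    exact hw u h3 h1 _ h2

/-- Two reflected paths from the same point: over a short interval on which `φ - φ'` oscillates
by at most `η`, the squared distance grows at most at a rate proportional to itself, up to
`η`. -/
theorem IsReflectedSolution.sq_dist_increment [CompleteSpace E] {v : ℝ → E → E} {x : E} {K : ℝ≥0}
    {C : ℝ} (hC0 : 0 ≤ C)
    (hC : ∀ x ∈ frontier Ω, ∀ n ∈ inwardNormals Ω x, ∀ y ∈ Ω,
      -(C * ‖y - x‖ ^ 2) ≤ inner ℝ (y - x) n)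
    (hK : ∀ t ∈ Icc (0 : ℝ) 1, LipschitzOnWith K (v t) Ω) {φ L φ' L' : ℝ → E}
    (h : IsReflectedSolution Ω v x φ L) (h' : IsReflectedSolution Ω v x φ' L') {l l' : ℝ → ℝ}
    {s t η : ℝ} (hs : 0 ≤ s) (hst : s ≤ t) (ht : t ≤ 1) (hη0 : 0 ≤ η) (hη1 : η ≤ 1)
    (hosc : ∀ u ∈ Icc s t, ‖(φ u - φ' u) - (φ s - φ' s)‖ ≤ η)
    (hl0 : 0 ≤ l t - l s) (hl0' : 0 ≤ l' t - l' s)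
    (hl : ‖L t - L s‖ ≤ l t - l s ∧
      ∀ (w : E) (c : ℝ), (∀ u ∈ Ioc s t, φ u ∈ frontier Ω → ∀ n ∈ inwardNormals Ω (φ u),
        inner ℝ w n ≤ c) → inner ℝ w (L t - L s) ≤ c * (l t - l s))
    (hl' : ‖L' t - L' s‖ ≤ l' t - l' s ∧
      ∀ (w : E) (c : ℝ), (∀ u ∈ Ioc s t, φ' u ∈ frontier Ω → ∀ n ∈ inwardNormals Ω (φ' u),
        inner ℝ w n ≤ c) → inner ℝ w (L' t - L' s) ≤ c * (l' t - l' s)) :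
    ‖φ t - φ' t‖ ^ 2 ≤ ‖φ s - φ' s‖ ^ 2 + (6 * K + 4 * C + 3) * (‖φ s - φ' s‖ ^ 2 + η) *
      ((t - s) + (l t - l s) + (l' t - l' s)) := by
  have hsI : s ∈ Icc (0 : ℝ) 1 := ⟨hs, hst.trans ht⟩
  have htI : t ∈ Icc (0 : ℝ) 1 := ⟨hs.trans hst, ht⟩
  have hsub : ∀ u ∈ Icc s t, u ∈ Icc (0 : ℝ) 1 := fun u hu => ⟨hs.trans hu.1, hu.2.trans ht⟩
  set f : ℝ → E := fun u => φ u - φ' u with hf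
  set a := ‖f s‖ with ha
  have ha0 : 0 ≤ a := norm_nonneg _
  have hfa : ∀ u ∈ Icc s t, ‖f u‖ ≤ a + η := fun u hu => by
    have := norm_sub_norm_le (f u) (f s)
    linarith [hosc u hu]
  set D := ∫ u in s..t, (v u (φ u) - v u (φ' u)) with hD
  have hDb : ‖D‖ ≤ K * (a + η) * (t - s) := by
    have := intervalIntegral.norm_integral_le_of_norm_le_const (a := s) (b := t)
      (f := fun u => v u (φ u) - v u (φ' u)) (C := K * (a + η)) ?_
    · rwa [abs_of_nonneg (sub_nonneg.2 hst)] at this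
    intro u hu
    rw [uIoc_of_le hst] at hu
    have huI : u ∈ Icc s t := ⟨hu.1.le, hu.2⟩
    have := (hK u (hsub u huI)).dist_le_mul _ (h.mem u (hsub u huI)) _ (h'.mem u (hsub u huI))
    rw [dist_eq_norm, dist_eq_norm] at this
    exact this.trans (by gcongr; exact hfa u huI)
  have hint : ∀ {ψ : ℝ → E}, IntegrableOn (fun u => v u (ψ u)) (Icc 0 1) →
      ∀ b ∈ Icc (0 : ℝ) 1, ∀ c ∈ Icc (0 : ℝ) 1,
        IntervalIntegrable (fun u => v u (ψ u)) volume b c := fun hψ b hb c hc => by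
    rw [intervalIntegrable_iff]
    refine hψ.mono_set (uIoc_subset_uIcc.trans ?_)
    exact (ordConnected_Icc.uIcc_subset hb hc)
  have h0I : (0 : ℝ) ∈ Icc (0 : ℝ) 1 := ⟨le_rfl, zero_le_one⟩
  have hincr : f t - f s = D + (L t - L s) - (L' t - L' s) := by
    rw [hD, intervalIntegral.integral_sub (hint h.integrable s hsI t htI)
      (hint h'.integrable s hsI t htI),
      ← intervalIntegral.integral_interval_sub_left (hint h.integrable 0 h0I t htI)
        (hint h.integrable 0 h0I s hsI),
      ← intervalIntegral.integral_interval_sub_left (hint h'.integrable 0 h0I t htI)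
        (hint h'.integrable 0 h0I s hsI)]
    simp only [hf]
    rw [h.equation t htI, h.equation s hsI, h'.equation t htI, h'.equation s hsI]
    abel
  -- a normal at time `u` is tested against the difference of the paths at time `s`, which costs
  -- the oscillation `η`; this serves for both paths, with their roles exchanged
  have hnormal : ∀ {ψ ψ' : ℝ → E}, (∀ u ∈ Icc s t, ψ' u ∈ Ω) →
      (∀ u ∈ Icc s t, ‖ψ u - ψ' u‖ ≤ a + η) →
      (∀ u ∈ Icc s t, ‖(ψ u - ψ' u) - (ψ s - ψ' s)‖ ≤ η) →
      ∀ u ∈ Ioc s t, ψ u ∈ frontier Ω → ∀ n ∈ inwardNormals Ω (ψ u),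
        inner ℝ (ψ s - ψ' s) n ≤ C * (a + η) ^ 2 + η := by
    intro ψ ψ' hΩ' hb ho u hu hfr n hn
    have huI : u ∈ Icc s t := ⟨hu.1.le, hu.2⟩
    have hn1 : ‖n‖ = 1 := by obtain ⟨r, -, h⟩ := hn; exact h.1
    have h1 := hC _ hfr n hn _ (hΩ' u huI)
    rw [← neg_sub (ψ u) (ψ' u), inner_neg_left, norm_neg] at h1
    have h2 := neg_le_of_abs_le (abs_real_inner_le_norm ((ψ u - ψ' u) - (ψ s - ψ' s)) n)
    rw [hn1, mul_one, inner_sub_left] at h2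
    have h3 : C * ‖ψ u - ψ' u‖ ^ 2 ≤ C * (a + η) ^ 2 := by gcongr; exact hb u huI
    linarith [ho u huI]
  have hLt := hl.2 (f s) _ (hnormal (fun u hu => h'.mem u (hsub u hu)) hfa hosc)
  have hLt' := hl'.2 (-f s) (C * (a + η) ^ 2 + η) (by
    have := hnormal (ψ := φ') (ψ' := φ) (fun u hu => h.mem u (hsub u hu))
      (fun u hu => by rw [norm_sub_rev]; exact hfa u hu)
      (fun u hu => by
        have := hosc u hu
        rwa [← norm_neg, show -((φ u - φ' u) - (φ s - φ' s)) = (φ' u - φ u) - (φ' s - φ s) by abel]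
          at this)
    simpa [hf] using this)
  rw [inner_neg_left] at hLt'
  have hDi : inner ℝ (f s) D ≤ a * (K * (a + η) * (t - s)) :=
    (real_inner_le_norm _ _).trans (by gcongr)
  have hinner : inner ℝ (f s) (f t - f s) ≤ a * (K * (a + η) * (t - s)) +
      (C * (a + η) ^ 2 + η) * ((l t - l s) + (l' t - l' s)) := by
    rw [hincr, inner_sub_right, inner_add_right]
    linarith
  have hnorm : ‖f t - f s‖ ≤ K * (a + η) * (t - s) + ((l t - l s) + (l' t - l' s)) := by
    rw [hincr]
    linarith [norm_sub_le (D + (L t - L s)) (L' t - L' s), norm_add_le D (L t - L s), hl.1, hl'.1]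
  have hsq : ‖f t - f s‖ ^ 2 ≤ η * (K * (a + η) * (t - s) + ((l t - l s) + (l' t - l' s))) := by
    rw [sq]
    exact mul_le_mul (hosc t ⟨hst, le_rfl⟩) hnorm (norm_nonneg _) hη0
  have hexpand : ‖f t‖ ^ 2 = a ^ 2 + 2 * inner ℝ (f s) (f t - f s) + ‖f t - f s‖ ^ 2 := by
    rw [ha, ← norm_add_sq_real, add_sub_cancel]
  have hK0 : (0 : ℝ) ≤ K := K.2
  have h1 : a * (a + η) ≤ 2 * (a ^ 2 + η) := by nlinarith [sq_nonneg (a - η)]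
  have h2 : η * (a + η) ≤ 2 * (a ^ 2 + η) := by nlinarith [sq_nonneg (a - η)]
  have h3 : (a + η) ^ 2 ≤ 2 * (a ^ 2 + η) := by nlinarith [sq_nonneg (a - η)]
  have hΔ : 0 ≤ t - s := sub_nonneg.2 hst
  have hΛ : 0 ≤ (l t - l s) + (l' t - l' s) := add_nonneg hl0 hl0'
  have hw : 0 ≤ a ^ 2 + η := by positivity
  change ‖f t‖ ^ 2 ≤ a ^ 2 + _
  have e1 : K * (t - s) * (a * (a + η)) ≤ K * (t - s) * (2 * (a ^ 2 + η)) := by gcongr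
  have e2 : K * (t - s) * (η * (a + η)) ≤ K * (t - s) * (2 * (a ^ 2 + η)) := by gcongr
  have e3 : C * ((l t - l s) + (l' t - l' s)) * (a + η) ^ 2
      ≤ C * ((l t - l s) + (l' t - l' s)) * (2 * (a ^ 2 + η)) := by gcongr
  have e4 : ((l t - l s) + (l' t - l' s)) * η
      ≤ ((l t - l s) + (l' t - l' s)) * (a ^ 2 + η) :=
    mul_le_mul_of_nonneg_left (le_add_of_nonneg_left (sq_nonneg a)) hΛ
  have e5 : 0 ≤ (4 * C + 3) * (a ^ 2 + η) * (t - s) := by positivity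
  have e6 : 0 ≤ 6 * K * (a ^ 2 + η) * ((l t - l s) + (l' t - l' s)) := by positivity
  rw [hexpand]
  linarith

/-- Uniqueness of the reflected path: the squared distance of two solutions satisfies a Gronwall
inequality with respect to `dt + dl + dl'`. -/
theorem IsReflectedSolution.eqOn [CompleteSpace E] {v : ℝ → E → E} {x : E} {K : ℝ≥0}
    {C : ℝ} (hC0 : 0 ≤ C)
    (hC : ∀ x ∈ frontier Ω, ∀ n ∈ inwardNormals Ω x, ∀ y ∈ Ω,
      -(C * ‖y - x‖ ^ 2) ≤ inner ℝ (y - x) n)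
    (hK : ∀ t ∈ Icc (0 : ℝ) 1, LipschitzOnWith K (v t) Ω) {φ L φ' L' : ℝ → E}
    (h : IsReflectedSolution Ω v x φ L) (h' : IsReflectedSolution Ω v x φ' L') :
    EqOn φ φ' (Icc 0 1) ∧ EqOn L L' (Icc 0 1) := by
  obtain ⟨l, hlm, hl⟩ := h.reflection.exists_increment_bound
  obtain ⟨l', hlm', hl'⟩ := h'.reflection.exists_increment_bound
  have hφ : EqOn φ φ' (Icc 0 1) := by
    intro T hT
    have hzero := eq_zero_of_small_increments (u := fun t => ‖φ t - φ' t‖ ^ 2)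
      (M := fun t => t + l t + l' t) (A := 6 * K + 4 * C + 3)
      (fun t => by positivity) (by simp [h.initial, h'.initial]) ?_ hT
    · exact sub_eq_zero.1 (norm_eq_zero.1 (pow_eq_zero_iff two_ne_zero |>.1 hzero))
    intro η hη hη1
    have huc := Metric.uniformContinuousOn_iff_le.1 (isCompact_Icc.uniformContinuousOn_of_continuous
      (h.continuousOn.sub h'.continuousOn)) η hη
    obtain ⟨δ, hδ, huc⟩ := huc
    refine ⟨δ, hδ, fun s t hs hst ht hsδ => ?_⟩
    have hosc : ∀ u ∈ Icc s t, ‖(φ u - φ' u) - (φ s - φ' s)‖ ≤ η := fun u hu => by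
      have := huc u ⟨hs.trans hu.1, hu.2.trans ht⟩ s ⟨hs, hst.trans ht⟩ (by
        rw [Real.dist_eq, abs_of_nonneg (sub_nonneg.2 hu.1)]
        linarith [hu.2])
      rwa [dist_eq_norm] at this
    have := IsReflectedSolution.sq_dist_increment hC0 hC hK h h' hs hst ht hη.le hη1 hosc
      (sub_nonneg.2 (hlm hst)) (sub_nonneg.2 (hlm' hst)) (hl s t hs hst ht) (hl' s t hs hst ht)
    convert this using 3
    ring
  refine ⟨hφ, fun t ht => ?_⟩
  have hdrift : ∫ s in (0 : ℝ)..t, v s (φ s) = ∫ s in (0 : ℝ)..t, v s (φ' s) := by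
    refine intervalIntegral.integral_congr fun s hs => ?_
    rw [uIcc_of_le ht.1] at hs
    simp only [hφ ⟨hs.1, hs.2.trans ht.2⟩]
  have e := h.equation t ht
  rw [hφ ht, h'.equation t ht, hdrift] at e
  exact (add_left_cancel e).symm

end Uniqueness

/-! ### The catching-up scheme -/

section CatchingUp

variable {E : Type*} [NormedAddCommGroup E] [InnerProductSpace ℝ E] {Ω : Set E}

/-- The nodes of the catching-up scheme with time step `1 / N`: follow the drift frozen at the
current node for one time step, then apply `P`, a choice of nearest points in `Ω`. -/
noncomputable def catchingUpNode (P : E → E) (w : ℝ → E → E) (x : E) (N : ℕ) : ℕ → E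
  | 0 => x
  | k + 1 => P (catchingUpNode P w x N k +
      ∫ s in (k / N : ℝ)..((k + 1 : ℕ) / N : ℝ), w s (catchingUpNode P w x N k))

/-- The sum of the projection corrections made by the catching-up scheme before step `k`. -/
noncomputable def catchingUpCorrection (P : E → E) (w : ℝ → E → E) (x : E) (N k : ℕ) : E :=
  catchingUpNode P w x N k - x - ∑ i ∈ Finset.range k,
    ∫ s in (i / N : ℝ)..((i + 1 : ℕ) / N : ℝ), w s (catchingUpNode P w x N i)

variable {P : E → E} {w : ℝ → E → E} {x : E} {g : ℝ → ℝ} {C : ℝ} {N : ℕ}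

theorem catchingUpNode_mem (hx : x ∈ Ω) (hP : ∀ q, P q ∈ Ω) (k : ℕ) :
    catchingUpNode P w x N k ∈ Ω := by
  cases k with
  | zero => exact hx
  | succ k => exact hP _

theorem catchingUpCorrection_succ_sub (k : ℕ) :
    catchingUpCorrection P w x N (k + 1) - catchingUpCorrection P w x N k =
      catchingUpNode P w x N (k + 1) - (catchingUpNode P w x N k +
        ∫ s in (k / N : ℝ)..((k + 1 : ℕ) / N : ℝ), w s (catchingUpNode P w x N k)) := by
  unfold catchingUpCorrection
  rw [Finset.sum_range_succ]
  abel

theorem norm_catchingUp_drift_le (hx : x ∈ Ω) (hP : ∀ q, P q ∈ Ω)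
    (hg : Integrable g) (hgw : ∀ s, ∀ y ∈ Ω, ‖w s y‖ ≤ g s * (1 + ‖y - x‖)) (k : ℕ) :
    ‖∫ s in (k / N : ℝ)..((k + 1 : ℕ) / N : ℝ), w s (catchingUpNode P w x N k)‖ ≤
      (1 + ‖catchingUpNode P w x N k - x‖) * ∫ s in (k / N : ℝ)..((k + 1 : ℕ) / N : ℝ), g s := by
  have hle : (k / N : ℝ) ≤ ((k + 1 : ℕ) / N : ℝ) := by gcongr; simp
  refine (intervalIntegral.norm_integral_le_of_norm_le hle (ae_of_all _ fun s _ =>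
    hgw s _ (catchingUpNode_mem hx hP k)) (hg.intervalIntegrable.mul_const _)).trans ?_
  rw [intervalIntegral.integral_mul_const, mul_comm]

theorem norm_catchingUp_step_le (hx : x ∈ Ω) (hP : ∀ q, P q ∈ Ω)
    (hmin : ∀ q, ∀ z ∈ Ω, ‖P q - q‖ ≤ ‖z - q‖) (k : ℕ) :
    ‖catchingUpCorrection P w x N (k + 1) - catchingUpCorrection P w x N k‖ ≤
        ‖∫ s in (k / N : ℝ)..((k + 1 : ℕ) / N : ℝ), w s (catchingUpNode P w x N k)‖ ∧
      ‖catchingUpNode P w x N (k + 1) - catchingUpNode P w x N k‖ ≤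
        2 * ‖∫ s in (k / N : ℝ)..((k + 1 : ℕ) / N : ℝ), w s (catchingUpNode P w x N k)‖ := by
  rw [catchingUpCorrection_succ_sub]
  set y := catchingUpNode P w x N k
  set D := ∫ s in (k / N : ℝ)..((k + 1 : ℕ) / N : ℝ), w s y
  have h1 : ‖catchingUpNode P w x N (k + 1) - (y + D)‖ ≤ ‖D‖ := by
    refine (hmin (y + D) y (catchingUpNode_mem hx hP k)).trans ?_
    simp
  refine ⟨h1, ?_⟩
  have := norm_add_le (catchingUpNode P w x N (k + 1) - (y + D)) D
  rw [show catchingUpNode P w x N (k + 1) - (y + D) + D = catchingUpNode P w x N (k + 1) - y by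
    abel] at this
  linarith

/-- The linear growth of the drift keeps the scheme bounded, uniformly in the time step. -/
theorem catchingUpNode_bound (hx : x ∈ Ω) (hP : ∀ q, P q ∈ Ω)
    (hmin : ∀ q, ∀ z ∈ Ω, ‖P q - q‖ ≤ ‖z - q‖) (hg : Integrable g)
    (hgw : ∀ s, ∀ y ∈ Ω, ‖w s y‖ ≤ g s * (1 + ‖y - x‖)) (k : ℕ) :
    1 + ‖catchingUpNode P w x N k - x‖ ≤ Real.exp (2 * ∫ s in (0 : ℝ)..(k / N : ℝ), g s) := by
  induction k with
  | zero => simp [catchingUpNode]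
  | succ k ih =>
    have h1 := norm_catchingUp_drift_le (N := N) hx hP hg hgw k
    have h2 := (norm_catchingUp_step_le (w := w) (N := N) hx hP hmin k).2
    have h3 := intervalIntegral.integral_add_adjacent_intervals
      (hg.intervalIntegrable (a := 0) (b := (k / N : ℝ)))
      (hg.intervalIntegrable (a := (k / N : ℝ)) (b := ((k + 1 : ℕ) / N : ℝ)))
    rw [← h3, mul_add, Real.exp_add]
    set G := ∫ s in (k / N : ℝ)..((k + 1 : ℕ) / N : ℝ), g s
    set y := catchingUpNode P w x N k
    have h4 : ‖catchingUpNode P w x N (k + 1) - x‖ ≤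
        ‖catchingUpNode P w x N (k + 1) - y‖ + ‖y - x‖ := by
      simpa using norm_add_le (catchingUpNode P w x N (k + 1) - y) (y - x)
    calc 1 + ‖catchingUpNode P w x N (k + 1) - x‖
        ≤ (1 + ‖y - x‖) * (2 * G + 1) := by linarith
      _ ≤ (1 + ‖y - x‖) * Real.exp (2 * G) := by gcongr; exact Real.add_one_le_exp _
      _ ≤ _ := by gcongr

/-- A common modulus `Γ` for all catching-up schemes: the primitive of `2 g`, up to the constant
that bounds `1 + ‖y - x‖` along the schemes. -/
noncomputable def catchingUpModulus (g : ℝ → ℝ) (t : ℝ) : ℝ :=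
  ∫ s in (0 : ℝ)..t, Real.exp (2 * ∫ s, g s) * (2 * g s)

theorem integrable_catchingUpModulus (hg : Integrable g) :
    Integrable fun s => Real.exp (2 * ∫ s, g s) * (2 * g s) :=
  (hg.const_mul 2).const_mul _

theorem catchingUpModulus_sub (hg : Integrable g) (a b : ℝ) :
    catchingUpModulus g b - catchingUpModulus g a =
      Real.exp (2 * ∫ s, g s) * (2 * ∫ s in a..b, g s) := by
  have hi := integrable_catchingUpModulus hg
  unfold catchingUpModulus
  rw [intervalIntegral.integral_interval_sub_left hi.intervalIntegrable hi.intervalIntegrable,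
    intervalIntegral.integral_const_mul, intervalIntegral.integral_const_mul]

theorem monotone_catchingUpModulus (hg : Integrable g) (hg0 : ∀ s, 0 ≤ g s) :
    Monotone (catchingUpModulus g) := fun a b hab => by
  rw [← sub_nonneg, catchingUpModulus_sub hg]
  have := intervalIntegral.integral_nonneg (μ := volume) hab fun s _ => hg0 s
  positivity

theorem continuous_catchingUpModulus (hg : Integrable g) : Continuous (catchingUpModulus g) :=
  intervalIntegral.continuous_primitive
    (fun _ _ => (integrable_catchingUpModulus hg).intervalIntegrable) 0

theorem two_mul_norm_catchingUp_drift_le (hx : x ∈ Ω) (hP : ∀ q, P q ∈ Ω)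
    (hmin : ∀ q, ∀ z ∈ Ω, ‖P q - q‖ ≤ ‖z - q‖) (hg : Integrable g) (hg0 : ∀ s, 0 ≤ g s)
    (hgw : ∀ s, ∀ y ∈ Ω, ‖w s y‖ ≤ g s * (1 + ‖y - x‖)) (k : ℕ) :
    2 * ‖∫ s in (k / N : ℝ)..((k + 1 : ℕ) / N : ℝ), w s (catchingUpNode P w x N k)‖ ≤
      catchingUpModulus g ((k + 1 : ℕ) / N) - catchingUpModulus g (k / N) := by
  have hk0 : (0 : ℝ) ≤ k / N := by positivity
  have hle : (k / N : ℝ) ≤ ((k + 1 : ℕ) / N : ℝ) := by gcongr; simp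
  have h1 := norm_catchingUp_drift_le (N := N) hx hP hg hgw k
  have h2 := catchingUpNode_bound (N := N) hx hP hmin hg hgw k
  have h3 : ∫ s in (0 : ℝ)..(k / N : ℝ), g s ≤ ∫ s, g s := by
    rw [intervalIntegral.integral_of_le hk0]
    exact setIntegral_le_integral hg (ae_of_all _ hg0)
  have h4 := intervalIntegral.integral_nonneg (μ := volume) hle fun s _ => hg0 s
  rw [catchingUpModulus_sub hg]
  have h5 : 1 + ‖catchingUpNode P w x N k - x‖ ≤ Real.exp (2 * ∫ s, g s) :=
    h2.trans (Real.exp_le_exp.2 (by linarith))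
  have h6 := mul_le_mul_of_nonneg_right h5 h4
  linarith

theorem norm_sub_le_of_norm_succ_sub_le {F : Type*} [NormedAddCommGroup F] {y : ℕ → F} {G : ℕ → ℝ}
    (h : ∀ k, ‖y (k + 1) - y k‖ ≤ G (k + 1) - G k) {j k : ℕ} (hjk : j ≤ k) :
    ‖y k - y j‖ ≤ G k - G j := by
  induction k, hjk using Nat.le_induction with
  | base => simp
  | succ k _ ih =>
    have := norm_add_le (y (k + 1) - y k) (y k - y j)
    rw [sub_add_sub_cancel] at this
    linarith [h k]

/-- Summing the normal inequalities of the single corrections, all base points being replaced by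
the node `y j` at the price of the oscillation `G k - G j`. -/
theorem inner_sum_corrections_ge {y ℓ : ℕ → E} {G : ℕ → ℝ} (hC0 : 0 ≤ C)
    (hy : ∀ k, ‖y (k + 1) - y k‖ ≤ G (k + 1) - G k)
    (hℓ : ∀ k, ‖ℓ (k + 1) - ℓ k‖ ≤ G (k + 1) - G k) {z : E}
    (hz : ∀ k, -(C * ‖ℓ (k + 1) - ℓ k‖ * ‖z - y (k + 1)‖ ^ 2) ≤
      inner ℝ (z - y (k + 1)) (ℓ (k + 1) - ℓ k)) {j k : ℕ} (hjk : j ≤ k) :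
    -((C * (‖z - y j‖ + (G k - G j)) ^ 2 + (G k - G j)) * (G k - G j)) ≤
      inner ℝ (z - y j) (ℓ k - ℓ j) := by
  have hGmono : Monotone G := monotone_nat_of_le_succ fun k => by
    linarith [hy k, norm_nonneg (y (k + 1) - y k)]
  obtain ⟨δ, hδ⟩ : ∃ δ, δ = G k - G j := ⟨_, rfl⟩
  rw [← hδ]
  have hδ0 : 0 ≤ δ := by linarith [hGmono hjk]
  suffices ∀ i, j ≤ i → i ≤ k → -((C * (‖z - y j‖ + δ) ^ 2 + δ) * (G i - G j)) ≤
      inner ℝ (z - y j) (ℓ i - ℓ j) by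
    have := this k hjk le_rfl
    rwa [← hδ] at this
  intro i hji
  induction i, hji using Nat.le_induction with
  | base => simp
  | succ i hji ih =>
    intro hik
    have ih := ih (by omega)
    have h1 : ‖y (i + 1) - y j‖ ≤ δ := by
      have := norm_sub_le_of_norm_succ_sub_le hy (show j ≤ i + 1 by omega)
      linarith [hGmono hik]
    have h2 : ‖z - y (i + 1)‖ ≤ ‖z - y j‖ + δ := by
      have := norm_sub_le (z - y j) (y (i + 1) - y j)
      rw [sub_sub_sub_cancel_right] at this
      linarith
    have h3 := neg_le_of_abs_le (abs_real_inner_le_norm (y (i + 1) - y j) (ℓ (i + 1) - ℓ i))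
    have h4 : ‖y (i + 1) - y j‖ * ‖ℓ (i + 1) - ℓ i‖ ≤ δ * ‖ℓ (i + 1) - ℓ i‖ := by gcongr
    have h5 : C * ‖ℓ (i + 1) - ℓ i‖ * ‖z - y (i + 1)‖ ^ 2 ≤
        C * ‖ℓ (i + 1) - ℓ i‖ * (‖z - y j‖ + δ) ^ 2 := by gcongr
    have h6 : (C * (‖z - y j‖ + δ) ^ 2 + δ) * ‖ℓ (i + 1) - ℓ i‖ ≤
        (C * (‖z - y j‖ + δ) ^ 2 + δ) * (G (i + 1) - G i) := by
      gcongr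
      exact hℓ i
    have e : inner ℝ (z - y j) (ℓ (i + 1) - ℓ j) = inner ℝ (z - y (i + 1)) (ℓ (i + 1) - ℓ i) +
        inner ℝ (y (i + 1) - y j) (ℓ (i + 1) - ℓ i) + inner ℝ (z - y j) (ℓ i - ℓ j) := by
      rw [← inner_add_left, sub_add_sub_cancel, ← inner_add_right, sub_add_sub_cancel]
    rw [e]
    linarith [hz i]

/-- The frozen drift of the scheme is close to the drift along any path uniformly close to it. -/
theorem norm_catchingUp_drift_sub_le {K : ℝ≥0} (hx : x ∈ Ω) (hP : ∀ q, P q ∈ Ω)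
    (hlip : ∀ s, LipschitzOnWith K (w s) Ω) (hint : ∀ y ∈ Ω, Integrable fun s => w s y)
    (hN : 0 < N) {ψ : ℝ → E} (hψ : ∀ s ∈ Icc (0 : ℝ) 1, ψ s ∈ Ω)
    (hψint : IntegrableOn (fun s => w s (ψ s)) (Icc 0 1)) {ε : ℝ}
    (hε : ∀ s ∈ Icc (0 : ℝ) 1, ‖catchingUpNode P w x N ⌊N * s⌋₊ - ψ s‖ ≤ ε) {k : ℕ}
    (hk : k ≤ N) :
    ‖catchingUpNode P w x N k - x - catchingUpCorrection P w x N k -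
      ∫ s in (0 : ℝ)..(k / N : ℝ), w s (ψ s)‖ ≤ K * ε := by
  have hN0 : (0 : ℝ) < N := by exact_mod_cast hN
  have hε0 : 0 ≤ ε := (norm_nonneg _).trans (hε 0 ⟨le_rfl, zero_le_one⟩)
  have hnode : ∀ i < k, (i / N : ℝ) ≤ ((i + 1 : ℕ) / N : ℝ) ∧ (0 : ℝ) ≤ i / N ∧
      ((i + 1 : ℕ) / N : ℝ) ≤ 1 := fun i hi => by
    refine ⟨by gcongr; simp, by positivity, ?_⟩
    rw [div_le_one hN0]
    exact_mod_cast (show i + 1 ≤ N by omega)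
  have hψi : ∀ i < k, IntervalIntegrable (fun s => w s (ψ s)) volume (i / N)
      ((i + 1 : ℕ) / N) := fun i hi => by
    obtain ⟨h1, h2, h3⟩ := hnode i hi
    rw [intervalIntegrable_iff, uIoc_of_le h1]
    exact hψint.mono_set fun s hs => ⟨h2.trans hs.1.le, hs.2.trans h3⟩
  have hsum := intervalIntegral.sum_integral_adjacent_intervals (a := fun i : ℕ => (i / N : ℝ)) hψi
  simp only [Nat.cast_zero, zero_div] at hsum
  unfold catchingUpCorrection
  rw [← hsum, sub_sub_cancel, ← Finset.sum_sub_distrib]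
  have hterm : ∀ i ∈ Finset.range k,
      ‖(∫ s in (i / N : ℝ)..((i + 1 : ℕ) / N : ℝ), w s (catchingUpNode P w x N i)) -
        ∫ s in (i / N : ℝ)..((i + 1 : ℕ) / N : ℝ), w s (ψ s)‖ ≤ K * ε * (1 / N) := by
    intro i hi
    rw [Finset.mem_range] at hi
    obtain ⟨h1, h2, h3⟩ := hnode i hi
    rw [← intervalIntegral.integral_sub
      (hint _ (catchingUpNode_mem hx hP i)).intervalIntegrable (hψi i hi)]
    have hlen : |((i + 1 : ℕ) / N : ℝ) - i / N| = 1 / N := by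
      rw [abs_of_nonneg (sub_nonneg.2 h1)]; push_cast; ring
    rw [← hlen]
    refine intervalIntegral.norm_integral_le_of_norm_le_const_ae ?_
    have hne : ∀ᵐ s : ℝ, s ≠ ((i + 1 : ℕ) / N : ℝ) := by simp [ae_iff, measure_singleton]
    filter_upwards [hne] with s hs hmem
    rw [uIoc_of_le h1] at hmem
    have hsI : s ∈ Icc (0 : ℝ) 1 := ⟨h2.trans hmem.1.le, hmem.2.trans h3⟩
    have hfloor : ⌊N * s⌋₊ = i := by
      have hlt := lt_of_le_of_ne hmem.2 hs
      have hgt := hmem.1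
      rw [lt_div_iff₀ hN0] at hlt
      rw [div_lt_iff₀ hN0] at hgt
      rw [Nat.floor_eq_iff (mul_nonneg hN0.le hsI.1)]
      push_cast at hlt
      constructor <;> linarith
    have hd := hε s hsI
    rw [hfloor] at hd
    have := (hlip s).dist_le_mul _ (catchingUpNode_mem (P := P) (w := w) (N := N) hx hP i) _
      (hψ s hsI)
    rw [dist_eq_norm, dist_eq_norm] at this
    exact this.trans (by gcongr)
  refine (norm_sum_le_of_le _ hterm).trans ?_
  rw [Finset.sum_const, Finset.card_range, nsmul_eq_mul]
  have hkN : (k : ℝ) * (1 / N) ≤ 1 := by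
    rw [mul_one_div, div_le_one hN0]; exact_mod_cast hk
  calc (k : ℝ) * (K * ε * (1 / N)) = K * ε * (k * (1 / N)) := by ring
    _ ≤ K * ε * 1 := by gcongr
    _ = K * ε := mul_one _

end CatchingUp

/-! ### Step paths -/

section StepPaths

variable {E : Type*} [NormedAddCommGroup E] {Ω : Set E} {w : ℝ → E → E}

theorem tendsto_floor_mul_div {t : ℝ} (ht : 0 ≤ t) :
    Tendsto (fun N : ℕ => (⌊(N : ℝ) * t⌋₊ : ℝ) / N) atTop (𝓝 t) := by
  have := (tendsto_nat_floor_mul_div_atTop ht).comp (tendsto_natCast_atTop_atTop (R := ℝ))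
  simpa [Function.comp_def, mul_comm] using this

theorem floor_mul_div_le {t : ℝ} (ht : 0 ≤ t) (N : ℕ) : (⌊(N : ℝ) * t⌋₊ : ℝ) / N ≤ t := by
  refine div_le_of_le_mul₀ N.cast_nonneg ht ?_
  rw [mul_comm]
  exact Nat.floor_le (by positivity)

theorem lt_floor_mul_div_add {N : ℕ} (hN : 0 < N) (t : ℝ) :
    t < (⌊(N : ℝ) * t⌋₊ : ℝ) / N + 1 / N := by
  have hN0 : (0 : ℝ) < N := by exact_mod_cast hN
  rw [← add_div, lt_div_iff₀ hN0, mul_comm]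
  exact Nat.lt_floor_add_one _

/-- Measurability of the drift along a continuous path in `Ω`, for a drift measurable in time and
continuous on `Ω` in space: approximate the path by its values at the times `i / N`. -/
theorem aestronglyMeasurable_drift (hcont : ∀ s, ContinuousOn (w s) Ω)
    (hint : ∀ y ∈ Ω, AEStronglyMeasurable fun s => w s y) {ψ : ℝ → E}
    (hψ : ∀ s ∈ Icc (0 : ℝ) 1, ψ s ∈ Ω) (hψc : ContinuousOn ψ (Icc 0 1)) :
    AEStronglyMeasurable (fun s => w s (ψ s)) (volume.restrict (Icc 0 1)) := by
  have hmem : ∀ s ∈ Icc (0 : ℝ) 1, ∀ N : ℕ, (⌊(N : ℝ) * s⌋₊ : ℝ) / N ∈ Icc (0 : ℝ) 1 :=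
    fun s hs N => ⟨by positivity, (floor_mul_div_le hs.1 N).trans hs.2⟩
  refine aestronglyMeasurable_of_tendsto_ae atTop
    (f := fun (N : ℕ) s => w s (ψ ((⌊(N : ℝ) * s⌋₊ : ℝ) / N))) (fun N => ?_) ?_
  · have hset : ∀ i : ℕ, MeasurableSet {s : ℝ | ⌊(N : ℝ) * s⌋₊ = i} := fun i =>
      (Nat.measurable_floor.comp (measurable_const_mul (N : ℝ))) (measurableSet_singleton i)
    have hcover : (Icc (0 : ℝ) 1) = ⋃ i : ℕ, Icc (0 : ℝ) 1 ∩ {s : ℝ | ⌊(N : ℝ) * s⌋₊ = i} := by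
      rw [← inter_iUnion]
      refine (inter_eq_left.2 fun s _ => ?_).symm
      simp
    rw [hcover, aestronglyMeasurable_iUnion_iff]
    intro i
    by_cases hi : (i / N : ℝ) ∈ Icc (0 : ℝ) 1
    · refine (hint _ (hψ _ hi)).restrict.congr ?_
      filter_upwards [ae_restrict_mem (measurableSet_Icc.inter (hset i))] with s hs
      have : ⌊(N : ℝ) * s⌋₊ = i := hs.2
      rw [this]
    · have : Icc (0 : ℝ) 1 ∩ {s : ℝ | ⌊(N : ℝ) * s⌋₊ = i} = ∅ := by
        refine eq_empty_of_forall_notMem fun s hs => hi ?_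
        have h2 : ⌊(N : ℝ) * s⌋₊ = i := hs.2
        have := hmem s hs.1 N
        rwa [h2] at this
      rw [this]
      simp
  · filter_upwards [ae_restrict_mem measurableSet_Icc] with s hs
    have h1 : Tendsto (fun N : ℕ => (⌊(N : ℝ) * s⌋₊ : ℝ) / N) atTop (𝓝[Icc 0 1] s) :=
      tendsto_nhdsWithin_iff.2 ⟨tendsto_floor_mul_div hs.1, Eventually.of_forall (hmem s hs)⟩
    have h2 : Tendsto (fun N : ℕ => ψ ((⌊(N : ℝ) * s⌋₊ : ℝ) / N)) atTop (𝓝[Ω] (ψ s)) :=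
      tendsto_nhdsWithin_iff.2 ⟨(hψc s hs).tendsto.comp h1,
        Eventually.of_forall fun N => hψ _ (hmem s hs N)⟩
    exact (hcont s _ (hψ s hs)).tendsto.comp h2

/-- Step paths with increments controlled by a common continuous modulus, up to the time step,
converge uniformly along a filter as soon as they converge pointwise. -/
theorem eventually_forall_norm_sub_le {l : Filter ℕ} (hl : l ≤ atTop) {Γ : ℝ → ℝ}
    (hΓ : Continuous Γ) {y : ℕ → ℝ → E} {ψ : ℝ → E}
    (hy : ∀ N s t, 0 ≤ s → s ≤ t → t ≤ 1 →
      ‖y N t - y N s‖ ≤ Γ ((⌊(N : ℝ) * t⌋₊ : ℝ) / N) - Γ ((⌊(N : ℝ) * s⌋₊ : ℝ) / N))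
    (hψ : ∀ s t, 0 ≤ s → s ≤ t → t ≤ 1 → ‖ψ t - ψ s‖ ≤ Γ t - Γ s)
    (hlim : ∀ t ∈ Icc (0 : ℝ) 1, Tendsto (fun N => y N t) l (𝓝 (ψ t))) {ε : ℝ} (hε : 0 < ε) :
    ∀ᶠ N in l, ∀ t ∈ Icc (0 : ℝ) 1, ‖y N t - ψ t‖ ≤ ε := by
  obtain ⟨δ, hδ, huc⟩ := Metric.uniformContinuousOn_iff_le.1
    (isCompact_Icc.uniformContinuousOn_of_continuous (s := Icc (0 : ℝ) 1) hΓ.continuousOn)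
    (ε / 3) (by positivity)
  obtain ⟨M, hM⟩ := exists_nat_gt (2 / δ)
  have hMlarge : ∀ N : ℕ, M ≤ N → 0 < N ∧ 1 / (N : ℝ) ≤ δ / 2 := fun N hN => by
    have h1 : (2 / δ : ℝ) < N := hM.trans_le (by exact_mod_cast hN)
    have h0 : (0 : ℝ) < N := lt_trans (by positivity) h1
    refine ⟨by exact_mod_cast h0, ?_⟩
    rw [div_lt_iff₀ hδ] at h1
    rw [div_le_iff₀ h0]
    linarith
  obtain ⟨hM0, hMδ⟩ := hMlarge M le_rfl
  have hnode : ∀ t ∈ Icc (0 : ℝ) 1, ∀ N : ℕ, (⌊(N : ℝ) * t⌋₊ : ℝ) / N ∈ Icc (0 : ℝ) 1 :=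
    fun t ht N => ⟨by positivity, (floor_mul_div_le ht.1 N).trans ht.2⟩
  have hfin : ∀ᶠ N in l, ∀ j ∈ Finset.range (M + 1), (j / M : ℝ) ∈ Icc (0 : ℝ) 1 →
      ‖y N (j / M) - ψ (j / M)‖ ≤ ε / 3 := by
    rw [eventually_all_finset]
    intro j _
    by_cases hj : (j / M : ℝ) ∈ Icc (0 : ℝ) 1
    · filter_upwards [(Metric.tendsto_nhds.1 (hlim _ hj)) (ε / 3) (by positivity)] with N hN _
      rw [dist_eq_norm] at hN
      exact hN.le
    · exact Eventually.of_forall fun N h => absurd h hj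
  filter_upwards [hfin, hl (eventually_ge_atTop M)] with N hN hMN t ht
  obtain ⟨hN0, hNδ⟩ := hMlarge N hMN
  obtain ⟨s, hs⟩ : ∃ s : ℝ, s = (⌊(M : ℝ) * t⌋₊ : ℝ) / M := ⟨_, rfl⟩
  have hsI : s ∈ Icc (0 : ℝ) 1 := hs ▸ hnode t ht M
  have hst : s ≤ t := hs ▸ floor_mul_div_le ht.1 M
  have hts : t < s + 1 / M := hs ▸ lt_floor_mul_div_add hM0 t
  have h1 : ‖y N s - ψ s‖ ≤ ε / 3 := by
    rw [hs] at hsI ⊢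
    refine hN _ ?_ hsI
    rw [Finset.mem_range, Nat.lt_succ_iff]
    refine Nat.floor_le_of_le ?_
    have : (0 : ℝ) ≤ M := M.cast_nonneg
    nlinarith [ht.2]
  have h2 : ‖y N t - y N s‖ ≤ ε / 3 := by
    refine (hy N s t hsI.1 hst ht.2).trans ((le_abs_self _).trans ?_)
    refine huc _ (hnode t ht N) _ (hnode s hsI N) ?_
    rw [Real.dist_eq, abs_le]
    have := floor_mul_div_le ht.1 N
    have := floor_mul_div_le hsI.1 N
    have := lt_floor_mul_div_add hN0 t
    have := lt_floor_mul_div_add hN0 s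
    constructor <;> linarith
  have h3 : ‖ψ t - ψ s‖ ≤ ε / 3 := by
    refine (hψ s t hsI.1 hst ht.2).trans ((le_abs_self _).trans (huc _ ht _ hsI ?_))
    rw [Real.dist_eq, abs_le]
    constructor <;> linarith
  have e : y N t - ψ t = (y N t - y N s) + (y N s - ψ s) - (ψ t - ψ s) := by abel
  rw [e]
  linarith [norm_sub_le ((y N t - y N s) + (y N s - ψ s)) (ψ t - ψ s),
    norm_add_le (y N t - y N s) (y N s - ψ s)]

end StepPaths

/-! ### The limit of the scheme -/

section Limit

variable {E : Type*} [NormedAddCommGroup E] [InnerProductSpace ℝ E] {Ω : Set E}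
  {w : ℝ → E → E} {x : E} {g : ℝ → ℝ} {C : ℝ}

/-- A limit of the catching-up schemes: a path `ψ` in `Ω` whose reflection term, the difference of
`ψ` and its drift, satisfies an integrated form of the normal cone inequality. Pointwise limits
along an ultrafilter exist by boundedness, and no subsequence has to be extracted. -/
theorem exists_catchingUp_limit [FiniteDimensional ℝ E] {K : ℝ≥0} (hΩ : IsClosed Ω) (hx : x ∈ Ω)
    (hC0 : 0 ≤ C)
    (hC : ∀ x ∈ frontier Ω, ∀ n ∈ inwardNormals Ω x, ∀ y ∈ Ω,
      -(C * ‖y - x‖ ^ 2) ≤ inner ℝ (y - x) n)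
    (hlip : ∀ s, LipschitzOnWith K (w s) Ω) (hint : ∀ y ∈ Ω, Integrable fun s => w s y)
    (hg : Integrable g) (hg0 : ∀ s, 0 ≤ g s)
    (hgw : ∀ s, ∀ y ∈ Ω, ‖w s y‖ ≤ g s * (1 + ‖y - x‖)) :
    ∃ ψ Λ : ℝ → E, (∀ t ∈ Icc (0 : ℝ) 1, ψ t ∈ Ω) ∧ ψ 0 = x ∧ ContinuousOn ψ (Icc 0 1) ∧
      IntegrableOn (fun s => w s (ψ s)) (Icc 0 1) ∧
      (∀ t ∈ Icc (0 : ℝ) 1, ψ t = x + (∫ s in (0 : ℝ)..t, w s (ψ s)) + Λ t) ∧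
      ∀ s t, 0 ≤ s → s ≤ t → t ≤ 1 →
        ‖Λ t - Λ s‖ ≤ catchingUpModulus g t - catchingUpModulus g s ∧
        ∀ z ∈ Ω, -((C * (‖z - ψ s‖ + (catchingUpModulus g t - catchingUpModulus g s)) ^ 2 +
          (catchingUpModulus g t - catchingUpModulus g s)) *
          (catchingUpModulus g t - catchingUpModulus g s)) ≤ inner ℝ (z - ψ s) (Λ t - Λ s) := by
  have : ProperSpace E := FiniteDimensional.proper ℝ E
  have hnear : ∀ q : E, ∃ p ∈ Ω, ∀ z ∈ Ω, ‖p - q‖ ≤ ‖z - q‖ := fun q => by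
    obtain ⟨p, hp, hpd⟩ := hΩ.exists_infDist_eq_dist ⟨x, hx⟩ q
    refine ⟨p, hp, fun z hz => ?_⟩
    rw [← dist_eq_norm, ← dist_eq_norm, dist_comm p, dist_comm z, ← hpd]
    exact infDist_le_dist_of_mem hz
  choose P hP hmin using hnear
  set Γ := catchingUpModulus g with hΓ
  have hΓm : Monotone Γ := monotone_catchingUpModulus hg hg0
  have hΓc : Continuous Γ := continuous_catchingUpModulus hg
  set y : ℕ → ℕ → E := catchingUpNode P w x with hy
  set ℓ : ℕ → ℕ → E := catchingUpCorrection P w x with hℓ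
  have hstep : ∀ N k, ‖y N (k + 1) - y N k‖ ≤ Γ ((k + 1 : ℕ) / N) - Γ (k / N) ∧
      ‖ℓ N (k + 1) - ℓ N k‖ ≤ Γ ((k + 1 : ℕ) / N) - Γ (k / N) := fun N k => by
    obtain ⟨h1, h2⟩ := norm_catchingUp_step_le (w := w) (N := N) hx hP hmin k
    have h3 := two_mul_norm_catchingUp_drift_le (N := N) hx hP hmin hg hg0 hgw k
    refine ⟨h2.trans h3, h1.trans (le_trans ?_ h3)⟩
    linarith [norm_nonneg (∫ s in (k / N : ℝ)..((k + 1 : ℕ) / N : ℝ),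
      w s (catchingUpNode P w x N k))]
  have hymem : ∀ N k, y N k ∈ Ω := fun N k => catchingUpNode_mem hx hP k
  have hnormal : ∀ N, ∀ z ∈ Ω, ∀ k, -(C * ‖ℓ N (k + 1) - ℓ N k‖ * ‖z - y N (k + 1)‖ ^ 2) ≤
      inner ℝ (z - y N (k + 1)) (ℓ N (k + 1) - ℓ N k) := fun N z hz k => by
    rw [hℓ, catchingUpCorrection_succ_sub]
    exact inner_sub_nearest_ge hC (hymem N (k + 1)) (hmin _) hz
  -- at time `t` the scheme with time step `1 / N` sits at its node `κ N t`
  set κ : ℕ → ℝ → ℕ := fun N t => ⌊(N : ℝ) * t⌋₊ with hκ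
  have hκm : ∀ N {s t : ℝ}, s ≤ t → κ N s ≤ κ N t := fun N s t hst =>
    Nat.floor_le_floor (by gcongr)
  have hincr : ∀ N s t, s ≤ t →
      ‖y N (κ N t) - y N (κ N s)‖ ≤ Γ (κ N t / N) - Γ (κ N s / N) := fun N s t hst =>
    norm_sub_le_of_norm_succ_sub_le (G := fun k : ℕ => Γ (k / N)) (fun k => (hstep N k).1)
      (hκm N hst)
  set U : Ultrafilter ℕ := hyperfilter ℕ with hU
  have hUle : (U : Filter ℕ) ≤ atTop := Nat.hyperfilter_le_atTop
  have hκlim : ∀ t, 0 ≤ t → Tendsto (fun N => (κ N t : ℝ) / N) U (𝓝 t) := fun t ht =>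
    (tendsto_floor_mul_div ht).mono_left hUle
  have hΓlim : ∀ t, 0 ≤ t → Tendsto (fun N => Γ ((κ N t : ℝ) / N)) U (𝓝 (Γ t)) := fun t ht =>
    (hΓc.tendsto t).comp (hκlim t ht)
  have hlim : ∀ t, ∃ p, 0 ≤ t → Tendsto (fun N => y N (κ N t)) U (𝓝 p) := fun t => by
    by_cases ht : 0 ≤ t
    · obtain ⟨p, -, hp⟩ := (isCompact_closedBall x (Γ t - Γ 0)).ultrafilter_le_nhds
        (U.map fun N => y N (κ N t)) (by
          rw [le_principal_iff, Ultrafilter.mem_coe, Ultrafilter.mem_map]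
          refine Filter.univ_mem' fun N => ?_
          rw [mem_preimage, mem_closedBall, dist_eq_norm]
          have h1 := hincr N 0 t ht
          have h2 := hΓm (floor_mul_div_le ht N)
          simp only [hκ, mul_zero, Nat.floor_zero, Nat.cast_zero, zero_div] at h1
          exact h1.trans (by linarith))
      exact ⟨p, fun _ => hp⟩
    · exact ⟨0, fun h => absurd h ht⟩
  choose ψ hψlim using hlim
  have hψmem : ∀ t ∈ Icc (0 : ℝ) 1, ψ t ∈ Ω := fun t ht =>
    hΩ.mem_of_tendsto (hψlim t ht.1) (Eventually.of_forall fun N => hymem N _)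
  have hψ0 : ψ 0 = x := by
    refine tendsto_nhds_unique (hψlim 0 le_rfl) ?_
    simp [hκ, hy, catchingUpNode]
  have hψincr : ∀ s t, 0 ≤ s → s ≤ t → t ≤ 1 → ‖ψ t - ψ s‖ ≤ Γ t - Γ s := fun s t hs hst _ =>
    le_of_tendsto_of_tendsto' ((hψlim t (hs.trans hst)).sub (hψlim s hs)).norm
      ((hΓlim t (hs.trans hst)).sub (hΓlim s hs)) fun N => hincr N s t hst
  have hψc : ContinuousOn ψ (Icc 0 1) := by
    refine fun s hs => tendsto_iff_norm_sub_tendsto_zero.2 ?_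
    have hz : Tendsto (fun t => |Γ t - Γ s|) (𝓝[Icc 0 1] s) (𝓝 0) := by
      have : ContinuousAt (fun t => |Γ t - Γ s|) s := by fun_prop
      simpa using this.tendsto.mono_left nhdsWithin_le_nhds
    refine squeeze_zero' (Eventually.of_forall fun _ => norm_nonneg _) ?_ hz
    filter_upwards [self_mem_nhdsWithin] with t ht
    rcases le_total s t with hst | hst
    · exact (hψincr s t hs.1 hst ht.2).trans (le_abs_self _)
    · rw [norm_sub_rev, abs_sub_comm]
      exact (hψincr t s ht.1 hst hs.2).trans (le_abs_self _)
  have hψint : IntegrableOn (fun s => w s (ψ s)) (Icc 0 1) := by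
    have hbound : Integrable (fun s => g s * (1 + (Γ 1 - Γ 0))) (volume.restrict (Icc 0 1)) :=
      hg.integrableOn.mul_const _
    refine hbound.mono' (aestronglyMeasurable_drift (fun s => (hlip s).continuousOn)
      (fun y hy => (hint y hy).aestronglyMeasurable) hψmem hψc) ?_
    filter_upwards [ae_restrict_mem measurableSet_Icc] with s hs
    refine (hgw s _ (hψmem s hs)).trans (mul_le_mul_of_nonneg_left ?_ (hg0 s))
    have := hψincr 0 s le_rfl hs.1 hs.2
    rw [hψ0] at this
    linarith [hΓm hs.2]
  set D : ℝ → E := fun t => ∫ s in (0 : ℝ)..t, w s (ψ s) with hD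
  have hDc : ContinuousOn D (Icc 0 1) := by
    have := intervalIntegral.continuousOn_primitive_interval (a := 0) (b := 1)
      (f := fun s => w s (ψ s)) (by rwa [uIcc_of_le zero_le_one])
    rwa [uIcc_of_le zero_le_one] at this
  have hdrift : ∀ t ∈ Icc (0 : ℝ) 1,
      Tendsto (fun N => ℓ N (κ N t)) U (𝓝 (ψ t - x - D t)) := fun t ht => by
    have hDlim : Tendsto (fun N => D ((κ N t : ℝ) / N)) U (𝓝 (D t)) :=
      (hDc t ht).tendsto.comp (tendsto_nhdsWithin_iff.2 ⟨hκlim t ht.1, Eventually.of_forall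
        fun N => ⟨by positivity, (floor_mul_div_le ht.1 N).trans ht.2⟩⟩)
    have herr : Tendsto (fun N => y N (κ N t) - x - ℓ N (κ N t) - D ((κ N t : ℝ) / N)) U
        (𝓝 0) := by
      rw [tendsto_zero_iff_norm_tendsto_zero, Metric.tendsto_nhds]
      intro ε hε
      have hK : (0 : ℝ) < K + 1 := by positivity
      have hunif := eventually_forall_norm_sub_le hUle hΓc (y := fun N t => y N (κ N t))
        (fun N s t _ hst _ => hincr N s t hst) hψincr (fun t ht => hψlim t ht.1)
        (div_pos hε hK)
      filter_upwards [hunif, hUle (eventually_gt_atTop 0)] with N hN hN0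
      have hkN : κ N t ≤ N := Nat.floor_le_of_le (by
        have : (0 : ℝ) ≤ N := N.cast_nonneg
        nlinarith [ht.2])
      have := norm_catchingUp_drift_sub_le hx hP hlip hint hN0 hψmem hψint hN hkN
      rw [dist_zero_right, norm_norm]
      refine this.trans_lt ?_
      rw [mul_div_assoc', div_lt_iff₀ hK]
      linarith
    have := (((hψlim t ht.1).sub_const x).sub hDlim).sub herr
    simp only [sub_zero] at this
    refine this.congr fun N => ?_
    abel
  refine ⟨ψ, fun t => ψ t - x - D t, hψmem, hψ0, hψc, hψint, fun t _ => by simp [hD],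
    fun s t hs hst ht => ?_⟩
  have htI : t ∈ Icc (0 : ℝ) 1 := ⟨hs.trans hst, ht⟩
  have hsI : s ∈ Icc (0 : ℝ) 1 := ⟨hs, hst.trans ht⟩
  have hΓst := (hΓlim t htI.1).sub (hΓlim s hs)
  have hℓst := (hdrift t htI).sub (hdrift s hsI)
  refine ⟨le_of_tendsto_of_tendsto' hℓst.norm hΓst fun N =>
    norm_sub_le_of_norm_succ_sub_le (G := fun k : ℕ => Γ (k / N)) (fun k => (hstep N k).2)
      (hκm N hst), fun z hz => ?_⟩
  have hzs := (hψlim s hs).const_sub z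
  refine le_of_tendsto_of_tendsto' ?_ (hzs.inner hℓst) fun N =>
    inner_sum_corrections_ge (G := fun k : ℕ => Γ (k / N)) hC0 (fun k => (hstep N k).1)
      (fun k => (hstep N k).2) (hnormal N z hz) (hκm N hst)
  exact ((((hzs.norm.add hΓst).pow 2).const_mul C).add hΓst |>.mul hΓst).neg

end Limit

/-! ### Absolutely continuous paths -/

section AbsolutelyContinuous

theorem AbsolutelyContinuousOnInterval.of_dist_le {X Y : Type*} [PseudoMetricSpace X]
    [PseudoMetricSpace Y] {f : ℝ → X} {F : ℝ → Y} {a b : ℝ}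
    (hF : AbsolutelyContinuousOnInterval F a b)
    (h : ∀ s ∈ uIcc a b, ∀ t ∈ uIcc a b, dist (f s) (f t) ≤ dist (F s) (F t)) :
    AbsolutelyContinuousOnInterval f a b := by
  refine squeeze_zero' (Eventually.of_forall fun I => Finset.sum_nonneg fun _ _ => dist_nonneg)
    ?_ hF
  refine eventually_inf_principal.2
    (Eventually.of_forall fun I hI => Finset.sum_le_sum fun i hi => ?_)
  exact h _ (hI.1 i hi).1 _ (hI.1 i hi).2

theorem norm_le_of_hasDerivAt_of_norm_sub_le {E : Type*} [NormedAddCommGroup E] [NormedSpace ℝ E]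
    {L : ℝ → E} {Γ : ℝ → ℝ} {t c : ℝ} {ξ : E} (hL : HasDerivAt L ξ t) (hΓ : HasDerivAt Γ c t)
    (h : ∀ᶠ ε in 𝓝[>] (0 : ℝ), ‖L (t + ε) - L t‖ ≤ Γ (t + ε) - Γ t) : ‖ξ‖ ≤ c := by
  refine le_of_tendsto_of_tendsto hL.tendsto_slope_zero_right.norm hΓ.tendsto_slope_zero_right ?_
  filter_upwards [h, self_mem_nhdsWithin] with ε hε hpos
  rw [mem_Ioi] at hpos
  rw [norm_smul, norm_inv, Real.norm_of_nonneg hpos.le, smul_eq_mul]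
  gcongr

/-- A path whose increments are dominated by those of the primitive of an integrable function is
the primitive of its derivative. -/
theorem integral_deriv_of_norm_sub_le {E : Type*} [NormedAddCommGroup E] [NormedSpace ℝ E]
    [FiniteDimensional ℝ E] {L : ℝ → E} {γ : ℝ → ℝ} (hγ : Integrable γ)
    (h : ∀ s t, 0 ≤ s → s ≤ t → t ≤ 1 →
      ‖L t - L s‖ ≤ (∫ u in (0 : ℝ)..t, γ u) - ∫ u in (0 : ℝ)..s, γ u) :
    (∀ᵐ t, t ∈ Ioo (0 : ℝ) 1 → HasDerivAt L (deriv L t) t ∧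
      HasDerivAt (fun t => ∫ u in (0 : ℝ)..t, γ u) (γ t) t ∧ ‖deriv L t‖ ≤ γ t) ∧
    IntegrableOn (deriv L) (Icc 0 1) ∧
    ∀ t ∈ Icc (0 : ℝ) 1, L t = L 0 + ∫ u in (0 : ℝ)..t, deriv L u := by
  have hcomplete : CompleteSpace E := FiniteDimensional.complete ℝ E
  have hAC : AbsolutelyContinuousOnInterval L 0 1 := by
    refine (hγ.intervalIntegrable.absolutelyContinuousOnInterval_intervalIntegral
      (a := 0) (b := 1) (c := 0) left_mem_uIcc).of_dist_le fun s hs t ht => ?_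
    rw [uIcc_of_le zero_le_one] at hs ht
    rcases le_total s t with hst | hst
    · rw [dist_comm, dist_eq_norm, dist_comm, Real.dist_eq]
      exact (h s t hs.1 hst ht.2).trans (le_abs_self _)
    · rw [dist_eq_norm, Real.dist_eq]
      exact (h t s ht.1 hst hs.2).trans (le_abs_self _)
  have hderiv : ∀ᵐ t, t ∈ Ioo (0 : ℝ) 1 → HasDerivAt L (deriv L t) t ∧
      HasDerivAt (fun t => ∫ u in (0 : ℝ)..t, γ u) (γ t) t ∧ ‖deriv L t‖ ≤ γ t := by
    filter_upwards [hAC.boundedVariationOn.ae_differentiableAt_of_mem_uIcc,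
      LocallyIntegrable.ae_hasDerivAt_integral hγ.locallyIntegrable] with t h1 h2 ht
    rw [uIcc_of_le zero_le_one] at h1
    have h3 := (h1 (Ioo_subset_Icc_self ht)).hasDerivAt
    refine ⟨h3, h2 0, norm_le_of_hasDerivAt_of_norm_sub_le h3 (h2 0) ?_⟩
    have hlt : ∀ᶠ ε in 𝓝[>] (0 : ℝ), ε < 1 - t :=
      (eventually_lt_nhds (sub_pos.2 ht.2)).filter_mono nhdsWithin_le_nhds
    filter_upwards [hlt, self_mem_nhdsWithin] with ε hε hpos
    rw [mem_Ioi] at hpos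
    exact h t (t + ε) ht.1.le (by linarith) (by linarith)
  have hne0 : ∀ᵐ t : ℝ, t ≠ 0 := by simp [ae_iff, measure_singleton]
  have hne1 : ∀ᵐ t : ℝ, t ≠ 1 := by simp [ae_iff, measure_singleton]
  have hint : IntegrableOn (deriv L) (Icc 0 1) := by
    refine Integrable.mono' hγ.integrableOn (aestronglyMeasurable_deriv _ _) ?_
    rw [ae_restrict_iff' measurableSet_Icc]
    filter_upwards [hderiv, hne0, hne1] with t ht h0 h1 htI
    exact (ht ⟨lt_of_le_of_ne htI.1 h0.symm, lt_of_le_of_ne htI.2 h1⟩).2.2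
  have hintI : IntervalIntegrable (deriv L) volume 0 1 := by
    rw [intervalIntegrable_iff, uIoc_of_le zero_le_one]
    exact hint.mono_set Ioc_subset_Icc_self
  have hsubI : ∀ s ∈ Icc (0 : ℝ) 1, ∀ t ∈ Icc (0 : ℝ) 1,
      IntervalIntegrable (deriv L) volume s t := fun s hs t ht =>
    hintI.mono_set (by
      rw [uIcc_of_le zero_le_one]
      exact ordConnected_Icc.uIcc_subset hs ht)
  refine ⟨hderiv, hint, ?_⟩
  have h0I : (0 : ℝ) ∈ Icc (0 : ℝ) 1 := ⟨le_rfl, zero_le_one⟩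
  have hprim : AbsolutelyContinuousOnInterval (fun t => ∫ u in (0 : ℝ)..t, deriv L u) 0 1 := by
    refine (hintI.norm.absolutelyContinuousOnInterval_intervalIntegral
      (c := 0) left_mem_uIcc).of_dist_le fun s hs t ht => ?_
    rw [uIcc_of_le zero_le_one] at hs ht
    rw [dist_eq_norm, Real.dist_eq,
      intervalIntegral.integral_interval_sub_left (hsubI 0 h0I s hs) (hsubI 0 h0I t ht),
      intervalIntegral.integral_interval_sub_left (hsubI 0 h0I s hs).norm (hsubI 0 h0I t ht).norm]
    exact intervalIntegral.norm_integral_le_abs_integral_norm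
  obtain ⟨c, hc⟩ := (hAC.sub hprim).const_of_ae_hasDerivAt_zero (by
    filter_upwards [hderiv, hintI.ae_hasDerivAt_integral, hne0, hne1] with t h1 h2 h3 h4 ht
    have h5 := h2 ht 0 left_mem_uIcc
    rw [uIcc_of_le zero_le_one] at ht
    have := (h1 ⟨lt_of_le_of_ne ht.1 h3.symm, lt_of_le_of_ne ht.2 h4⟩).1.sub h5
    rwa [sub_self] at this)
  intro t ht
  rw [uIcc_of_le zero_le_one] at hc
  have e0 := hc 0 h0I
  have et := hc t ht
  simp only [Pi.sub_apply, intervalIntegral.integral_same, sub_zero] at e0 et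
  rw [e0, ← et, sub_add_cancel]

/-- The primitive of a nonnegative integrable density, as a Stieltjes function. -/
theorem exists_stieltjesFunction_withDensity {ρ : ℝ → ℝ} (hρ : Integrable ρ)
    (hρ0 : ∀ s, 0 ≤ ρ s) :
    ∃ l : StieltjesFunction ℝ, l 0 = 0 ∧ Continuous l ∧
      l.measure = volume.withDensity fun s => ENNReal.ofReal (ρ s) := by
  have hcont : Continuous fun t => ∫ s in (0 : ℝ)..t, ρ s :=
    intervalIntegral.continuous_primitive (fun _ _ => hρ.intervalIntegrable) 0
  have hsub : ∀ a b, (∫ s in (0 : ℝ)..b, ρ s) - ∫ s in (0 : ℝ)..a, ρ s = ∫ s in a..b, ρ s :=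
    fun a b => intervalIntegral.integral_interval_sub_left hρ.intervalIntegrable
      hρ.intervalIntegrable
  refine ⟨⟨fun t => ∫ s in (0 : ℝ)..t, ρ s, fun a b hab => ?_,
    fun t => hcont.continuousWithinAt⟩, intervalIntegral.integral_same, hcont, ?_⟩
  · rw [← sub_nonneg, hsub]
    exact intervalIntegral.integral_nonneg hab fun s _ => hρ0 s
  · refine Measure.ext_of_Ioc _ _ fun a b hab => ?_
    rw [StieltjesFunction.measure_Ioc, withDensity_apply _ measurableSet_Ioc,
      ← ofReal_integral_eq_lintegral_ofReal hρ.integrableOn (ae_of_all _ hρ0),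
      ← intervalIntegral.integral_of_le hab.le, ← hsub]

end AbsolutelyContinuous

/-! ### From increments to normal reflection, and existence -/

section Reflection

variable {E : Type*} [NormedAddCommGroup E] [InnerProductSpace ℝ E] {Ω : Set E}

/-- At a point where `Λ` and the modulus `Γ` are differentiable, the integrated normal inequality
becomes the proximal normal inequality for the derivative of `Λ`. -/
theorem inner_deriv_ge {C : ℝ} {Λ : ℝ → E} {Γ : ℝ → ℝ} {p z ξ : E} {t c : ℝ}
    (hΛ : HasDerivAt Λ ξ t) (hΓ : HasDerivAt Γ c t)
    (h : ∀ᶠ ε in 𝓝[>] (0 : ℝ), -((C * (‖z - p‖ + (Γ (t + ε) - Γ t)) ^ 2 + (Γ (t + ε) - Γ t)) *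
      (Γ (t + ε) - Γ t)) ≤ inner ℝ (z - p) (Λ (t + ε) - Λ t)) :
    -(C * ‖z - p‖ ^ 2 * c) ≤ inner ℝ (z - p) ξ := by
  have hincr : Tendsto (fun ε => Γ (t + ε) - Γ t) (𝓝[>] 0) (𝓝 0) := by
    have hc : ContinuousAt (fun ε => Γ (t + ε)) 0 :=
      ContinuousAt.comp (by simpa using hΓ.continuousAt) (by fun_prop)
    have := (hc.tendsto.sub_const (Γ t)).mono_left (nhdsWithin_le_nhds (s := Ioi 0))
    simpa using this
  have hleft := (((((hincr.const_add ‖z - p‖).pow 2).const_mul C).add hincr).mul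
    hΓ.tendsto_slope_zero_right).neg
  have hright := (tendsto_const_nhds (x := z - p)).inner (𝕜 := ℝ) hΛ.tendsto_slope_zero_right
  rw [add_zero, add_zero] at hleft
  refine le_of_tendsto_of_tendsto hleft hright ?_
  filter_upwards [h, self_mem_nhdsWithin] with ε hε hpos
  rw [mem_Ioi] at hpos
  rw [inner_smul_right, smul_eq_mul]
  have := mul_le_mul_of_nonneg_left hε (inv_nonneg.2 hpos.le)
  calc _ = ε⁻¹ * -((C * (‖z - p‖ + (Γ (t + ε) - Γ t)) ^ 2 + (Γ (t + ε) - Γ t)) *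
      (Γ (t + ε) - Γ t)) := by ring
    _ ≤ _ := this

theorem normalize_mem_inwardNormals {p ξ : E} {B : ℝ} (hξ : ξ ≠ 0) (hB : 0 ≤ B)
    (h : ∀ z ∈ Ω, -(B * ‖z - p‖ ^ 2) ≤ inner ℝ (z - p) ξ) :
    ‖ξ‖⁻¹ • ξ ∈ inwardNormals Ω p := by
  have hξ0 : 0 < ‖ξ‖ := norm_pos_iff.2 hξ
  -- any radius at most `‖ξ‖ / (2 B)` would do; `B + 1` avoids a division by zero
  have hr : 0 < ‖ξ‖ / (2 * (B + 1)) := by positivity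
  refine ⟨_, hr, (mem_inwardNormalsOfRadius_iff hr).2 ⟨?_, fun z hz => ?_⟩⟩
  · rw [norm_smul, norm_inv, norm_norm, inv_mul_cancel₀ hξ0.ne']
  · rw [inner_smul_right]
    have e : 2 * (‖ξ‖ / (2 * (B + 1))) * (‖ξ‖⁻¹ * inner ℝ (z - p) ξ) =
        inner ℝ (z - p) ξ / (B + 1) := by field_simp
    rw [e, le_div_iff₀ (by positivity)]
    nlinarith [h z hz, sq_nonneg ‖z - p‖]

/-- A path `Λ` dominated by an absolutely continuous modulus and satisfying the integrated normal
inequality along `ψ` is a normal reflection term: `dl = |Λ'| dt` and `n = Λ' / |Λ'|`. -/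
theorem isNormalReflection_of_increments [FiniteDimensional ℝ E] {C : ℝ} (hC0 : 0 ≤ C)
    {ψ Λ : ℝ → E} {γ : ℝ → ℝ} (hγ : Integrable γ) (hψ : ∀ t ∈ Icc (0 : ℝ) 1, ψ t ∈ Ω)
    (hΛ0 : Λ 0 = 0) {Γ : ℝ → ℝ} (hΓ : Γ = fun t => ∫ u in (0 : ℝ)..t, γ u)
    (h : ∀ s t, 0 ≤ s → s ≤ t → t ≤ 1 → ‖Λ t - Λ s‖ ≤ Γ t - Γ s ∧
      ∀ z ∈ Ω, -((C * (‖z - ψ s‖ + (Γ t - Γ s)) ^ 2 + (Γ t - Γ s)) * (Γ t - Γ s)) ≤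
        inner ℝ (z - ψ s) (Λ t - Λ s)) :
    IsNormalReflection Ω ψ Λ := by
  obtain ⟨hderiv, hint, hprim⟩ := integral_deriv_of_norm_sub_le (L := Λ) hγ fun s t hs hst ht => by
    have := (h s t hs hst ht).1
    rwa [hΓ] at this
  have hmeas := stronglyMeasurable_deriv Λ
  set ρ : ℝ → ℝ := (Icc (0 : ℝ) 1).indicator fun s => ‖deriv Λ s‖ with hρ
  have hρm : Measurable ρ := hmeas.norm.measurable.indicator measurableSet_Icc
  have hρI : ∀ s ∈ Ioc (0 : ℝ) 1, ρ s = ‖deriv Λ s‖ := fun s hs =>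
    indicator_of_mem (Ioc_subset_Icc_self hs) _
  obtain ⟨l, hl0, hlc, hlm⟩ := exists_stieltjesFunction_withDensity (ρ := ρ)
    ((integrable_indicator_iff measurableSet_Icc).2 hint.norm)
    (fun s => indicator_nonneg (fun _ _ => norm_nonneg _) s)
  have hrestrict : ∀ S, MeasurableSet S → l.measure.restrict S =
      (volume.restrict S).withDensity fun s => ENNReal.ofReal (ρ s) := fun S hS => by
    rw [hlm, restrict_withDensity hS]
  have hnormal : ∀ᵐ s ∂(l.measure.restrict (Ioc 0 1)),
      ‖deriv Λ s‖⁻¹ • deriv Λ s ∈ inwardNormals Ω (ψ s) ∧ ψ s ∈ Ω := by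
    rw [hrestrict _ measurableSet_Ioc, ae_withDensity_iff hρm.ennreal_ofReal,
      ae_restrict_iff' measurableSet_Ioc]
    have hne1 : ∀ᵐ t : ℝ, t ≠ 1 := by simp [ae_iff, measure_singleton]
    filter_upwards [hderiv, hne1] with s hs h1 hsI hne
    obtain ⟨hd, hdΓ, hle⟩ := hs ⟨hsI.1, lt_of_le_of_ne hsI.2 h1⟩
    rw [hρI s hsI, Ne, ENNReal.ofReal_eq_zero, not_le] at hne
    refine ⟨?_, hψ s (Ioc_subset_Icc_self hsI)⟩
    refine normalize_mem_inwardNormals (B := C * γ s) (norm_pos_iff.1 hne)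
      (mul_nonneg hC0 ((norm_nonneg _).trans hle)) fun z hz => ?_
    rw [← hΓ] at hdΓ
    have := inner_deriv_ge (C := C) (p := ψ s) (z := z) hd hdΓ ?_
    · rwa [mul_right_comm] at this
    have hlt : ∀ᶠ ε in 𝓝[>] (0 : ℝ), ε < 1 - s :=
      (eventually_lt_nhds (sub_pos.2 (lt_of_le_of_ne hsI.2 h1))).filter_mono nhdsWithin_le_nhds
    filter_upwards [hlt, self_mem_nhdsWithin] with ε hε hpos
    rw [mem_Ioi] at hpos
    exact (h s (s + ε) hsI.1.le (by linarith) (by linarith)).2 z hz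
  refine ⟨l, fun s => ‖deriv Λ s‖⁻¹ • deriv Λ s, hl0, hlc.continuousOn, ?_, ?_, ?_, ?_⟩
  · filter_upwards [hnormal] with s hs
    exact mem_frontier_of_inwardNormal hs.2 hs.1
  · exact (hmeas.norm.measurable.inv.stronglyMeasurable.smul hmeas).aestronglyMeasurable
  · filter_upwards [hnormal] with s hs
    exact hs.1
  · intro t ht
    rw [hprim t ht, hΛ0, zero_add, intervalIntegral.integral_of_le ht.1,
      hrestrict _ measurableSet_Ioc, integral_withDensity_eq_integral_toReal_smul
        hρm.ennreal_ofReal (ae_of_all _ fun _ => ENNReal.ofReal_lt_top)]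
    refine setIntegral_congr_fun measurableSet_Ioc fun s hs => ?_
    have hsI : s ∈ Ioc (0 : ℝ) 1 := ⟨hs.1, hs.2.trans ht.2⟩
    simp only [hρI s hsI, ENNReal.toReal_ofReal (norm_nonneg _)]
    rcases eq_or_ne (deriv Λ s) 0 with h0 | h0
    · simp [h0]
    · rw [smul_inv_smul₀ (norm_ne_zero_iff.2 h0)]

/-- Existence of the reflected path: the limit of the catching-up schemes is a solution. -/
theorem exists_isReflectedSolution [FiniteDimensional ℝ E] {C : ℝ} {K : ℝ≥0} {v : ℝ → E → E}
    {x : E} (hΩ : IsClosed Ω) (hx : x ∈ Ω) (hC0 : 0 ≤ C)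
    (hC : ∀ x ∈ frontier Ω, ∀ n ∈ inwardNormals Ω x, ∀ y ∈ Ω,
      -(C * ‖y - x‖ ^ 2) ≤ inner ℝ (y - x) n)
    (hlip : ∀ t ∈ Icc (0 : ℝ) 1, LipschitzOnWith K (v t) Ω)
    (hint : ∀ y ∈ Ω, IntegrableOn (fun t => v t y) (Icc 0 1)) :
    ∃ φ L : ℝ → E, IsReflectedSolution Ω v x φ L := by
  -- outside `[0, 1]` the drift is replaced by zero
  set w : ℝ → E → E := fun t y => (Icc (0 : ℝ) 1).indicator (fun t => v t y) t with hw
  set g : ℝ → ℝ := (Icc (0 : ℝ) 1).indicator fun t => ‖v t x‖ + K with hg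
  have hwI : ∀ t ∈ Icc (0 : ℝ) 1, ∀ y, w t y = v t y := fun t ht y => indicator_of_mem ht _
  have hwO : ∀ t, t ∉ Icc (0 : ℝ) 1 → ∀ y, w t y = 0 := fun t ht y => indicator_of_notMem ht _
  have hg0 : ∀ t, 0 ≤ g t := fun t => indicator_nonneg (fun _ _ => by positivity) t
  have hgi : Integrable g := (integrable_indicator_iff measurableSet_Icc).2
    ((hint x hx).norm.add (integrableOn_const (by simp)))
  have hwlip : ∀ t, LipschitzOnWith K (w t) Ω := fun t => by
    by_cases ht : t ∈ Icc (0 : ℝ) 1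
    · rw [show w t = v t from funext (hwI t ht)]
      exact hlip t ht
    · rw [show w t = fun _ => 0 from funext (hwO t ht)]
      exact LipschitzOnWith.of_dist_le_mul fun a _ b _ => by
        rw [dist_self]; positivity
  have hgw : ∀ t, ∀ y ∈ Ω, ‖w t y‖ ≤ g t * (1 + ‖y - x‖) := fun t y hy => by
    by_cases ht : t ∈ Icc (0 : ℝ) 1
    · rw [hwI t ht, show g t = ‖v t x‖ + K from indicator_of_mem ht _]
      have h1 := (hlip t ht).dist_le_mul y hy x hx
      rw [dist_eq_norm, dist_eq_norm] at h1
      have h2 := norm_sub_norm_le (v t y) (v t x)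
      have h3 : 0 ≤ ‖v t x‖ * ‖y - x‖ := by positivity
      have h4 : (0 : ℝ) ≤ K := K.2
      linarith
    · rw [hwO t ht, norm_zero]
      exact mul_nonneg (hg0 t) (by positivity)
  obtain ⟨ψ, Λ, hmem, hψ0, hψc, hψint, heq, hincr⟩ := exists_catchingUp_limit hΩ hx hC0 hC hwlip
    (fun y hy => (integrable_indicator_iff measurableSet_Icc).2 (hint y hy)) hgi hg0 hgw
  have hΛ0 : Λ 0 = 0 := by
    have := heq 0 ⟨le_rfl, zero_le_one⟩
    rw [intervalIntegral.integral_same, add_zero, hψ0] at this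
    exact left_eq_add.1 this
  refine ⟨ψ, Λ, hψc, hmem, hψ0, ?_, fun t ht => ?_, ?_⟩
  · exact hψint.congr_fun (fun s hs => hwI s hs _) measurableSet_Icc
  · rw [heq t ht]
    congr 2
    refine intervalIntegral.integral_congr fun s hs => ?_
    rw [uIcc_of_le ht.1] at hs
    exact hwI s ⟨hs.1, hs.2.trans ht.2⟩ _
  · exact isNormalReflection_of_increments hC0 (integrable_catchingUpModulus hgi) hmem hΛ0 rfl hincr

end Reflection

/-! ### Existence and uniqueness -/

theorem theorem1 (d : ℕ) (Ω : Set (EuclideanSpace ℝ (Fin d))) (hΩ : IsClosed Ω)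
    (hsphere : UniformExteriorSphere Ω) (hcone : UniformCone Ω)
    (v : ℝ → EuclideanSpace ℝ (Fin d) → EuclideanSpace ℝ (Fin d))
    (hv_time : ∀ y ∈ Ω, IntegrableOn (fun t => v t y) (Icc 0 1))
    (hv_lip : ∃ K : ℝ≥0, ∀ t ∈ Icc (0 : ℝ) 1, LipschitzOnWith K (v t) Ω)
    (x : EuclideanSpace ℝ (Fin d)) (hx : x ∈ Ω) :
    (∃ φ L : ℝ → EuclideanSpace ℝ (Fin d), IsReflectedSolution Ω v x φ L) ∧
    ∀ φ L φ' L' : ℝ → EuclideanSpace ℝ (Fin d),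
      IsReflectedSolution Ω v x φ L → IsReflectedSolution Ω v x φ' L' →
        EqOn φ φ' (Icc 0 1) ∧ EqOn L L' (Icc 0 1) := by
  obtain ⟨C, hC0, hC⟩ := exists_forall_inwardNormal_inner_ge hΩ hsphere hcone
  obtain ⟨K, hK⟩ := hv_lip
  exact ⟨exists_isReflectedSolution hΩ hx hC0 hC hK hv_time,
    fun φ L φ' L' h h' => h.eqOn hC0 hC hK h'⟩
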